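/- Let $L\subset\mathbb R$ be a lattice, that is, $L=a\mathbb Z$ for some $a>0$. Let $\alpha$ be a tempered distribution on $\mathbb R$ whose closed support $\operatorname{supp}(\alpha)$ is contained in a finite union of translates of $L$. Let $\widehat\alpha$ be its Fourier transform, defined by $\widehat\alpha(\varphi)=\alpha(\widehat\varphi)$ with $\widehat\varphi(t)=\int_{\mathbb R}\varphi(x)e^{-2\pi i t x}\,dx$ for Schwartz functions $\varphi$, and suppose that the spectrum $S=\operatorname{supp}(\widehat\alpha)$ is a locally finite set, that is, a set with no finite accumulation points. Then $\alpha$ can be represented, with this same $L$, in the form $$\alpha=\sum_{(\tau,\omega,l,p)}c(\tau,\omega,l,p)\sum_{\lambda\in L}\lambda^{l}\,e^{2\pi i\lambda\omega}\,\delta^{(p)}_{\lambda+\tau},$$ where $(\tau,\omega,l,p)$ runs through a finite set of quadruples with $\tau,\omega$ real numbers and $l,p$ nonnegative integers, the $c(\tau,\omega,l,p)$ are complex numbers, $\delta^{(p)}_{x}$ is the $p$-th distributional derivative of the unit point mass at $x$ (so $\delta^{(p)}_x(\varphi)=(-1)^p\varphi^{(p)}(x)$), $\lambda^0=1$ also for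 $\lambda=0$, and each inner sum converges unconditionally to a tempered distribution when tested against any Schwartz function. -/

import Mathlib

open scoped SchwartzMap FourierTransform Topology Pointwise

/-- A set of real numbers is locally finite if it has no (finite) accumulation point. -/
def IsLocallyFiniteSet (S : Set ℝ) : Prop :=
  ∀ x : ℝ, ¬ AccPt x (Filter.principal S)

/-- The `p`-th distributional derivative `δ_x^{(p)}` of the Dirac mass at `x`, that is,
`φ ↦ (-1)^p φ^{(p)}(x)`. -/
noncomputable def deltaDeriv (p : ℕ) (x : ℝ) : 𝓢'(ℝ, ℂ) :=
  (TemperedDistribution.derivCLM ℂ)^[p] (TemperedDistribution.delta x)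

/-- The term `y ^ l * exp (2 π i y ω) * δ_{y + τ}^{(p)}`. -/
noncomputable def poissonTerm (τ ω : ℝ) (l p : ℕ) (y : ℝ) : 𝓢'(ℝ, ℂ) :=
  ((y : ℂ) ^ l * Complex.exp (2 * Real.pi * Complex.I * y * ω)) • deltaDeriv p (y + τ)

/-! Write `L = a ℤ`. On `supp α` the character `exp (-2πix/a)` takes finitely many values, so a
trigonometric polynomial `P` vanishes there. A tempered distribution has finite order, hence some
power `P ^ m` annihilates `α` (`exists_vanishing_order`, `exists_diffOp_family_eq_zero`). On the
Fourier side this is a linear recurrence among the translates of the transform by multiples of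
`1/a`. If a coset of `a⁻¹ ℤ` has enough consecutive points off the spectrum, the recurrence removes
the whole coset from it. Local finiteness then leaves finitely many cosets (`exists_finite_cosets`).

Now the roles are exchanged: `exp (2πiax)` takes finitely many values on the spectrum, so the
translates of `α` by multiples of `a` satisfy a recurrence whose roots have modulus one
(`exists_diffOp_translates_eq_zero`). Locally `α` is a combination of derivatives of point masses of
bounded order (`exists_apply_eq_sum_jets`). Along each coset `τ + a ℤ` their coefficients solve this
recurrence, hence are exponential polynomials with real frequencies (`mem_expPolySpan_of_diffOp`),
which is the asserted form. -/

/-! ### Constant-coefficient recurrences and exponential polynomials on `ℤ`. -/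

/-- The shift `f ↦ f (· + 1)` on two-sided sequences. -/
def seqShift : Module.End ℂ (ℤ → ℂ) where
  toFun f n := f (n + 1)
  map_add' _ _ := rfl
  map_smul' _ _ := rfl

/-- The monic difference operator `∏ (E - z)` over `z ∈ s`, with `E` the shift. -/
noncomputable def diffOp (s : Multiset ℂ) : Module.End ℂ (ℤ → ℂ) :=
  Polynomial.aeval seqShift (s.map fun z => Polynomial.X - Polynomial.C z).prod

@[simp] lemma diffOp_zero : diffOp 0 = 1 := by simp [diffOp]

/-- The factors commute, so `E - z` may act first; inductions on `s` then lower the order of the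
recurrence by one. -/
lemma diffOp_cons_apply (z : ℂ) (s : Multiset ℂ) (f : ℤ → ℂ) :
    diffOp (z ::ₘ s) f = diffOp s (fun n => f (n + 1) - z * f n) := by
  have : diffOp (z ::ₘ s) = diffOp s * (seqShift - algebraMap ℂ _ z) := by
    simp [diffOp, mul_comm (Polynomial.X - Polynomial.C z)]
  rw [this, Module.End.mul_apply]
  congr 1

lemma geometric_of_shift_eq {z : ℂ} (hz : z ≠ 0) {f : ℤ → ℂ} (h : ∀ n, f (n + 1) = z * f n)
    (m n : ℤ) : f (m + n) = z ^ n * f m := by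
  induction n using Int.induction_on with
  | zero => simp
  | succ i hi => rw [← add_assoc, h, hi, zpow_add_one₀ hz]; ring
  | pred i hi =>
    have := h (m + (-i - 1))
    rw [show m + (-(i : ℤ) - 1) + 1 = m + -i by ring, hi] at this
    rw [zpow_sub_one₀ hz, mul_right_comm, this]
    field_simp

/-- Applying `E - z` shortens both the recurrence and the window of zeros by one. By induction `f`
is then geometric of ratio `z`, and one zero spreads in both directions because `z ≠ 0`. -/
lemma eq_zero_of_diffOp_of_window {s : Multiset ℂ} (hs : ∀ z ∈ s, z ≠ 0) (m : ℤ) {f : ℤ → ℂ}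
    (h : diffOp s f = 0) (hw : ∀ n, m ≤ n → n < m + s.card → f n = 0) : f = 0 := by
  induction s using Multiset.induction_on generalizing f with
  | empty => simpa using h
  | cons z s ih =>
    rw [diffOp_cons_apply] at h
    have key := ih (fun w hw => hs w (Multiset.mem_cons_of_mem hw)) h (fun n h1 h2 => by
      rw [Multiset.card_cons] at hw
      push_cast at hw
      rw [hw n h1 (by omega), hw (n + 1) (by omega) (by omega)]; simp)
    have h0 : f m = 0 := hw m le_rfl (by simp)
    have hz : z ≠ 0 := hs z (Multiset.mem_cons_self _ _)
    funext n
    have := geometric_of_shift_eq hz (fun n => sub_eq_zero.mp (congrFun key n)) m (n - m)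
    simpa [h0] using this

/-- The exponential monomial `n ↦ (a n) ^ l * exp (2 π i a n θ)`. -/
noncomputable def expMonomial (a θ : ℝ) (l : ℕ) (n : ℤ) : ℂ :=
  ((a * n : ℝ) : ℂ) ^ l * Complex.exp (2 * Real.pi * Complex.I * ((a * n : ℝ) : ℂ) * θ)

/-- The space of exponential polynomials with unimodular characters. -/
noncomputable def expPolySpan (a : ℝ) : Submodule ℂ (ℤ → ℂ) :=
  Submodule.span ℂ (Set.range fun q : ℝ × ℕ => expMonomial a q.1 q.2)

lemma expMonomial_mem (a θ : ℝ) (l : ℕ) : expMonomial a θ l ∈ expPolySpan a :=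
  Submodule.subset_span ⟨(θ, l), rfl⟩

/-- Binomial expansion of `(a n + a) ^ l`. The top coefficient `w - z`, with `w = exp (2πiaθ)`,
vanishes exactly at resonance, where the degree drops. -/
lemma expMonomial_diff (a θ : ℝ) (l : ℕ) (z : ℂ) (n : ℤ) :
    expMonomial a θ l (n + 1) - z * expMonomial a θ l n =
      (Complex.exp (2 * Real.pi * Complex.I * a * θ) - z) * expMonomial a θ l n +
      Complex.exp (2 * Real.pi * Complex.I * a * θ) *
        ∑ i ∈ Finset.range l, ((a : ℂ) ^ (l - i) * (l.choose i)) * expMonomial a θ i n := by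
  have h1 : expMonomial a θ l (n + 1) = Complex.exp (2 * Real.pi * Complex.I * a * θ) *
      ∑ i ∈ Finset.range (l + 1), ((a : ℂ) ^ (l - i) * (l.choose i)) * expMonomial a θ i n := by
    have h2 : Complex.exp (2 * Real.pi * Complex.I * ((a * (n + 1 : ℤ) : ℝ) : ℂ) * θ) =
        Complex.exp (2 * Real.pi * Complex.I * a * θ) *
          Complex.exp (2 * Real.pi * Complex.I * ((a * n : ℝ) : ℂ) * θ) := by
      rw [← Complex.exp_add]; push_cast; ring_nf
    have h3 : ((a * (n + 1 : ℤ) : ℝ) : ℂ) = ((a * n : ℝ) : ℂ) + a := by push_cast; ring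
    rw [expMonomial, h2, h3, add_pow, Finset.sum_mul, Finset.mul_sum]
    refine Finset.sum_congr rfl fun i _ => ?_
    rw [expMonomial]; ring
  rw [h1, Finset.sum_range_succ]
  simp
  ring

/-- Undetermined coefficients, by induction on the degree: the monomial of degree `l`, or of degree
`l + 1` at resonance, produces the right leading term, and the solutions `H i` already found cancel
the lower ones. -/
lemma exists_shift_sub_eq_expMonomial {a : ℝ} (ha : a ≠ 0) (z : ℂ) (θ : ℝ) (l : ℕ) :
    ∃ h ∈ expPolySpan a, ∀ n, h (n + 1) - z * h n = expMonomial a θ l n := by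
  set w := Complex.exp (2 * Real.pi * Complex.I * a * θ) with hw
  have hw0 : w ≠ 0 := Complex.exp_ne_zero _
  induction l using Nat.strong_induction_on with
  | _ l ih =>
    choose! H hH1 hH2 using ih
    by_cases hz : w = z
    -- `k` is the degree `l` coefficient of the difference of the degree `l + 1` monomial; `a ≠ 0`
    -- makes it invertible.
    · set k : ℂ := w * (a * (l + 1)) with hk
      have hk0 : k ≠ 0 := mul_ne_zero hw0 (mul_ne_zero (by exact_mod_cast ha)
        (by exact_mod_cast Nat.succ_ne_zero l))
      refine ⟨k⁻¹ • (expMonomial a θ (l + 1) - w • ∑ i ∈ Finset.range l,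
        ((a : ℂ) ^ (l + 1 - i) * ((l + 1).choose i)) • H i), ?_, fun n => ?_⟩
      · refine Submodule.smul_mem _ _ (Submodule.sub_mem _ (expMonomial_mem _ _ _)
          (Submodule.smul_mem _ _ (Submodule.sum_mem _ fun i hi =>
            Submodule.smul_mem _ _ (hH1 i (Finset.mem_range.mp hi)))))
      · have e1 := expMonomial_diff a θ (l + 1) z n
        rw [← hw, ← hz, sub_self, zero_mul, zero_add, Finset.sum_range_succ] at e1
        have e2 : ∑ i ∈ Finset.range l, ((a : ℂ) ^ (l + 1 - i) * ((l + 1).choose i)) *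
            expMonomial a θ i n = ∑ i ∈ Finset.range l,
            ((a : ℂ) ^ (l + 1 - i) * ((l + 1).choose i)) * H i (n + 1) -
            z * ∑ i ∈ Finset.range l, ((a : ℂ) ^ (l + 1 - i) * ((l + 1).choose i)) * H i n := by
          rw [Finset.mul_sum, ← Finset.sum_sub_distrib]
          refine Finset.sum_congr rfl fun i hi => ?_
          rw [← hH2 i (Finset.mem_range.mp hi) n]; ring
        rw [e2] at e1
        simp only [Pi.smul_apply, Pi.sub_apply, Finset.sum_apply, smul_eq_mul]
        have e3 : (a : ℂ) ^ (l + 1 - l) * ((l + 1).choose l) = a * (l + 1) := by simp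
        rw [e3] at e1
        rw [← hz] at e1 ⊢
        have : k * expMonomial a θ l n = w * (a * (l + 1) * expMonomial a θ l n) := by
          rw [hk]; ring
        rw [eq_comm, ← mul_right_inj' hk0, this]
        field_simp
        linear_combination -e1
    · have hk0 : w - z ≠ 0 := sub_ne_zero.mpr hz
      refine ⟨(w - z)⁻¹ • (expMonomial a θ l - w • ∑ i ∈ Finset.range l,
        ((a : ℂ) ^ (l - i) * (l.choose i)) • H i), ?_, fun n => ?_⟩
      · refine Submodule.smul_mem _ _ (Submodule.sub_mem _ (expMonomial_mem _ _ _)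
          (Submodule.smul_mem _ _ (Submodule.sum_mem _ fun i hi =>
            Submodule.smul_mem _ _ (hH1 i (Finset.mem_range.mp hi)))))
      · have e1 := expMonomial_diff a θ l z n
        have e2 : ∑ i ∈ Finset.range l, ((a : ℂ) ^ (l - i) * (l.choose i)) *
            expMonomial a θ i n = ∑ i ∈ Finset.range l,
            ((a : ℂ) ^ (l - i) * (l.choose i)) * H i (n + 1) -
            z * ∑ i ∈ Finset.range l, ((a : ℂ) ^ (l - i) * (l.choose i)) * H i n := by
          rw [Finset.mul_sum, ← Finset.sum_sub_distrib]
          refine Finset.sum_congr rfl fun i hi => ?_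
          rw [← hH2 i (Finset.mem_range.mp hi) n]; ring
        rw [e2, ← hw] at e1
        simp only [Pi.smul_apply, Pi.sub_apply, Finset.sum_apply, smul_eq_mul]
        rw [eq_comm, ← mul_right_inj' hk0]
        field_simp
        linear_combination -e1

lemma exists_shift_sub_eq {a : ℝ} (ha : a ≠ 0) (z : ℂ) {g : ℤ → ℂ} (hg : g ∈ expPolySpan a) :
    ∃ h ∈ expPolySpan a, ∀ n, h (n + 1) - z * h n = g n := by
  induction hg using Submodule.span_induction with
  | mem x hx =>
    obtain ⟨q, rfl⟩ := hx
    exact exists_shift_sub_eq_expMonomial ha z q.1 q.2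
  | zero => exact ⟨0, Submodule.zero_mem _, by simp⟩
  | add x y _ _ hx hy =>
    obtain ⟨h1, m1, e1⟩ := hx
    obtain ⟨h2, m2, e2⟩ := hy
    refine ⟨h1 + h2, Submodule.add_mem _ m1 m2, fun n => ?_⟩
    simp only [Pi.add_apply]
    rw [← e1, ← e2]; ring
  | smul c x _ hx =>
    obtain ⟨h1, m1, e1⟩ := hx
    refine ⟨c • h1, Submodule.smul_mem _ _ m1, fun n => ?_⟩
    simp only [Pi.smul_apply, smul_eq_mul]
    rw [← e1]; ring

lemma exists_exp_eq_of_norm_eq_one {a : ℝ} (ha : a ≠ 0) {z : ℂ} (hz : ‖z‖ = 1) :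
    ∃ θ : ℝ, Complex.exp (2 * Real.pi * Complex.I * a * θ) = z := by
  refine ⟨z.arg / (2 * Real.pi * a), ?_⟩
  conv_rhs => rw [← Complex.norm_mul_exp_arg_mul_I z, hz]
  have : (a : ℂ) ≠ 0 := by exact_mod_cast ha
  have : (Real.pi : ℂ) ≠ 0 := by exact_mod_cast Real.pi_ne_zero
  push_cast
  rw [one_mul]
  congr 1
  field_simp

/-- By induction `(E - z) f` is an exponential polynomial. Subtracting a particular solution leaves
a multiple of `z ^ n`, which is a character with real frequency since `‖z‖ = 1`. -/
lemma mem_expPolySpan_of_diffOp {a : ℝ} (ha : a ≠ 0) {s : Multiset ℂ} (hs : ∀ z ∈ s, ‖z‖ = 1)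
    {f : ℤ → ℂ} (h : diffOp s f = 0) : f ∈ expPolySpan a := by
  induction s using Multiset.induction_on generalizing f with
  | empty => simp only [diffOp_zero, Module.End.one_apply] at h; simp [h]
  | cons z s ih =>
    rw [diffOp_cons_apply] at h
    obtain ⟨g, hg, hgf⟩ := exists_shift_sub_eq ha z
      (ih (fun w hw => hs w (Multiset.mem_cons_of_mem hw)) h)
    have hz : ‖z‖ = 1 := hs z (Multiset.mem_cons_self _ _)
    have hz0 : z ≠ 0 := by rintro rfl; simp at hz
    obtain ⟨θ, hθ⟩ := exists_exp_eq_of_norm_eq_one ha hz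
    have e : f = g + (f 0 - g 0) • expMonomial a θ 0 := by
      funext n
      have := geometric_of_shift_eq (f := f - g) hz0 (fun n => by
        have := hgf n
        simp only [Pi.sub_apply]
        linear_combination -this) 0 n
      simp only [Pi.sub_apply, zero_add] at this
      simp only [Pi.add_apply, Pi.smul_apply, smul_eq_mul, expMonomial, pow_zero, one_mul]
      have e2 : Complex.exp (2 * Real.pi * Complex.I * ((a * n : ℝ) : ℂ) * θ) = z ^ n := by
        rw [← hθ, ← Complex.exp_int_mul]; push_cast; ring_nf
      rw [e2]
      linear_combination this
    rw [e]
    exact Submodule.add_mem _ hg (Submodule.smul_mem _ _ (expMonomial_mem _ _ _))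

lemma exists_sum_of_mem_expPolySpan {a : ℝ} {f : ℤ → ℂ} (hf : f ∈ expPolySpan a) :
    ∃ c : (ℝ × ℕ) →₀ ℂ, ∀ n, f n = ∑ q ∈ c.support, c q * expMonomial a q.1 q.2 n := by
  obtain ⟨c, rfl⟩ := Finsupp.mem_span_range_iff_exists_finsupp.mp hf
  refine ⟨c, fun n => ?_⟩
  simp [Finsupp.sum, Finset.sum_apply]

/-! ### Order of vanishing and smooth cutoffs. -/

section

open scoped ContDiff Manifold

/-- `f` vanishes to order `m` at `x`: all derivatives of order `< m` vanish there. -/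
def VanishesToOrder (m : ℕ) (f : ℝ → ℂ) (x : ℝ) : Prop :=
  ∀ j < m, iteratedDeriv j f x = 0

lemma norm_iteratedDeriv_mul_le {f g : ℝ → ℂ} (hf : ContDiff ℝ ∞ f) (hg : ContDiff ℝ ∞ g)
    (n : ℕ) (x : ℝ) : ‖iteratedDeriv n (fun y => f y * g y) x‖ ≤
      ∑ i ∈ Finset.range (n + 1), (n.choose i : ℝ) * ‖iteratedDeriv i f x‖ *
        ‖iteratedDeriv (n - i) g x‖ := by
  simpa only [norm_iteratedFDeriv_eq_norm_iteratedDeriv] using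
    norm_iteratedFDeriv_mul_le (n := n) hf hg x (by exact_mod_cast le_top)

/-- In each Leibniz term of order `j < m + k`, either `i < m` or `j - i < k`. -/
lemma VanishesToOrder.mul {m k : ℕ} {f g : ℝ → ℂ} {x : ℝ} (hf : ContDiff ℝ ∞ f)
    (hg : ContDiff ℝ ∞ g) (h : VanishesToOrder m f x) (h' : VanishesToOrder k g x) :
    VanishesToOrder (m + k) (fun y => f y * g y) x := by
  intro j hj
  rw [← norm_le_zero_iff]
  refine (norm_iteratedDeriv_mul_le hf hg j x).trans (le_of_eq ?_)
  refine Finset.sum_eq_zero fun i hi => ?_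
  rw [Finset.mem_range] at hi
  by_cases him : i < m
  · rw [h i him]; simp
  · rw [h' (j - i) (by omega)]; simp

lemma vanishesToOrder_zero (f : ℝ → ℂ) (x : ℝ) : VanishesToOrder 0 f x := fun _ h => by omega

lemma VanishesToOrder.mul_left {k : ℕ} {f g : ℝ → ℂ} {x : ℝ} (hf : ContDiff ℝ ∞ f)
    (hg : ContDiff ℝ ∞ g) (h' : VanishesToOrder k g x) :
    VanishesToOrder k (fun y => f y * g y) x := by
  simpa using (vanishesToOrder_zero f x).mul hf hg h'

lemma VanishesToOrder.pow {f : ℝ → ℂ} {x : ℝ} (hf : ContDiff ℝ ∞ f) (h : f x = 0) (m : ℕ) :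
    VanishesToOrder m (fun y => f y ^ m) x := by
  induction m with
  | zero => exact vanishesToOrder_zero _ _
  | succ m ih =>
    have h1 : VanishesToOrder 1 f x := fun j hj => by
      obtain rfl : j = 0 := by omega
      simpa using h
    simpa only [pow_succ] using ih.mul (hf.pow m) hf h1

lemma iteratedDeriv_eq_zero_of_notMem_tsupport {f : ℝ → ℂ} {x : ℝ} (h : x ∉ tsupport f) (j : ℕ) :
    iteratedDeriv j f x = 0 := by
  have h1 : f =ᶠ[𝓝 x] 0 := notMem_tsupport_iff_eventuallyEq.mp h
  rw [(h1.iteratedDeriv_eq j)]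
  simp [Pi.zero_def]

/-- Induction on `m`: the bound for `deriv f` integrates to one more power through the mean value
inequality on the ball of radius `|y - x|`. -/
lemma VanishesToOrder.exists_bound {m : ℕ} {f : ℝ → ℂ} {x : ℝ} (hf : ContDiff ℝ ∞ f)
    (h : VanishesToOrder m f x) :
    ∃ C, 0 ≤ C ∧ ∀ y, |y - x| ≤ 1 → ‖f y‖ ≤ C * |y - x| ^ m := by
  induction m generalizing f with
  | zero =>
    obtain ⟨C, hC⟩ := (isCompact_closedBall x 1).exists_bound_of_continuousOn
      hf.continuous.continuousOn
    refine ⟨max C 0, le_max_right _ _, fun y hy => ?_⟩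
    rw [pow_zero, mul_one]
    exact (hC y (by simpa [Real.dist_eq] using hy)).trans (le_max_left _ _)
  | succ m ih =>
    have hd : ContDiff ℝ ∞ (deriv f) := by
      have := contDiff_infty_iff_deriv.mp hf
      exact this.2
    obtain ⟨C, hC0, hC⟩ := ih hd (fun j hj => by
      rw [← iteratedDeriv_succ']; exact h (j + 1) (by omega))
    refine ⟨C, hC0, fun y hy => ?_⟩
    have h0 : f x = 0 := by simpa using h 0 (by omega)
    have key := Convex.norm_image_sub_le_of_norm_deriv_le (f := f) (C := C * |y - x| ^ m)
      (s := Metric.closedBall x |y - x|) (x := x) (y := y)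
      (fun z _ => (hf.differentiable (by simp)).differentiableAt)
      (fun z hz => by
        rw [Metric.mem_closedBall, Real.dist_eq] at hz
        refine (hC z (hz.trans hy)).trans ?_
        gcongr)
      (convex_closedBall _ _) (by simp) (by simp [Real.dist_eq])
    rw [h0, sub_zero, Real.norm_eq_abs] at key
    rw [pow_succ]; linarith

/-- A fixed smooth bump function on `ℝ`, equal to `1` near `0` and supported in `[-1, 1]`. -/
noncomputable def unitBump (x : ℝ) : ℂ :=
  ((⟨1 / 2, 1, by norm_num, by norm_num⟩ : ContDiffBump (0 : ℝ)) x : ℝ)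

lemma contDiff_unitBump : ContDiff ℝ ∞ unitBump :=
  Complex.ofRealCLM.contDiff.comp (ContDiffBump.contDiff _)

lemma unitBump_eq_one {x : ℝ} (h : |x| ≤ 1 / 2) : unitBump x = 1 := by
  rw [unitBump, ContDiffBump.one_of_mem_closedBall _ (by simpa using h)]
  simp

lemma unitBump_eq_zero {x : ℝ} (h : 1 ≤ |x|) : unitBump x = 0 := by
  rw [unitBump, ContDiffBump.zero_of_le_dist _ (by simpa using h)]
  simp

lemma hasCompactSupport_unitBump : HasCompactSupport unitBump :=
  HasCompactSupport.intro (isCompact_closedBall (0 : ℝ) 1) fun x hx =>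
    unitBump_eq_zero (by simp at hx; exact hx.le)

/-- The bump function rescaled to be supported in `[c - r, c + r]`. -/
noncomputable def scaledBump (c r x : ℝ) : ℂ := unitBump (r⁻¹ * (x - c))

lemma contDiff_scaledBump (c r : ℝ) : ContDiff ℝ ∞ (scaledBump c r) :=
  contDiff_unitBump.comp (by fun_prop)

lemma scaledBump_eq_one {c r x : ℝ} (hr : 0 < r) (h : |x - c| ≤ r / 2) : scaledBump c r x = 1 := by
  refine unitBump_eq_one ?_
  rw [abs_mul, abs_of_pos (inv_pos.mpr hr), inv_mul_le_iff₀ hr]; linarith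

lemma scaledBump_eq_zero {c r x : ℝ} (hr : 0 < r) (h : r ≤ |x - c|) : scaledBump c r x = 0 := by
  refine unitBump_eq_zero ?_
  rw [abs_mul, abs_of_pos (inv_pos.mpr hr), le_inv_mul_iff₀ hr]; linarith

lemma tsupport_scaledBump_subset {c r : ℝ} (hr : 0 < r) :
    tsupport (scaledBump c r) ⊆ Metric.closedBall c r := by
  refine closure_minimal (fun x hx => ?_) Metric.isClosed_closedBall
  by_contra hx'
  refine hx (scaledBump_eq_zero hr ?_)
  simp [Real.dist_eq] at hx'
  exact hx'.le

lemma hasCompactSupport_scaledBump {c r : ℝ} (hr : 0 < r) : HasCompactSupport (scaledBump c r) :=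
  (isCompact_closedBall c r).of_isClosed_subset (isClosed_tsupport _)
    (tsupport_scaledBump_subset hr)

lemma hasTemperateGrowth_scaledBump {c r : ℝ} (hr : 0 < r) :
    (scaledBump c r).HasTemperateGrowth :=
  (hasCompactSupport_scaledBump hr).hasTemperateGrowth (contDiff_scaledBump c r)

lemma iteratedDeriv_scaledBump (c r x : ℝ) (j : ℕ) :
    iteratedDeriv j (scaledBump c r) x = (r⁻¹ : ℝ) ^ j • iteratedDeriv j unitBump (r⁻¹ * (x - c)) := by
  have h1 : scaledBump c r = fun z => (fun y => unitBump (r⁻¹ * y)) (z - c) := rfl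
  rw [h1, congrFun (iteratedDeriv_comp_sub_const j (fun y => unitBump (r⁻¹ * y)) c) x]
  have := congrFun (iteratedDeriv_comp_const_smul (n := j)
    (contDiff_unitBump.of_le (by exact_mod_cast le_top)) r⁻¹) (x - c)
  simpa using this

lemma exists_bound_iteratedDeriv_unitBump (n : ℕ) :
    ∃ B, 0 ≤ B ∧ ∀ j ≤ n, ∀ x, ‖iteratedDeriv j unitBump x‖ ≤ B := by
  have h1 : ∀ j, ∃ B, ∀ x, ‖iteratedDeriv j unitBump x‖ ≤ B := fun j => by
    obtain ⟨B, hB⟩ := (hasCompactSupport_unitBump.toSchwartzMap contDiff_unitBump).decay' 0 j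
    refine ⟨B, fun x => ?_⟩
    have := hB x
    rwa [pow_zero, one_mul, norm_iteratedFDeriv_eq_norm_iteratedDeriv] at this
  choose B hB using h1
  refine ⟨∑ j ∈ Finset.range (n + 1), |B j|, by positivity, fun j hj x => ?_⟩
  exact ((hB j x).trans (le_abs_self _)).trans
    (Finset.single_le_sum (f := fun j => |B j|) (fun _ _ => abs_nonneg _)
      (Finset.mem_range.mpr (by omega)))

/-! ### Finite order, and annihilation of test functions flat on the support. -/

namespace TemperedDistribution

open Distribution

/-- A tempered distribution has finite order. -/
lemma exists_order (u : 𝓢'(ℝ, ℂ)) : ∃ (K N : ℕ) (C : ℝ), 0 ≤ C ∧ ∀ (φ : 𝓢(ℝ, ℂ)) (M : ℝ), 0 ≤ M →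
    (∀ k ≤ K, ∀ n ≤ N, ∀ x : ℝ, |x| ^ k * ‖iteratedDeriv n φ x‖ ≤ M) → ‖u φ‖ ≤ C * M := by
  let q : Seminorm ℂ 𝓢(ℝ, ℂ) := (normSeminorm ℂ ℂ).comp (u : 𝓢(ℝ, ℂ) →ₗ[ℂ] ℂ)
  have hq : Continuous q := continuous_norm.comp (map_continuous u)
  obtain ⟨s, C, -, hC⟩ := Seminorm.bound_of_continuous (schwartz_withSeminorms ℂ ℝ ℂ) q hq
  refine ⟨s.sup Prod.fst, s.sup Prod.snd, C, C.2, fun φ M hM h => ?_⟩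
  refine (hC φ).trans ?_
  rw [smul_apply, NNReal.smul_def, smul_eq_mul]
  gcongr
  refine Seminorm.finset_sup_apply_le hM fun i hi => ?_
  rw [SchwartzMap.schwartzSeminormFamily_apply]
  refine SchwartzMap.seminorm_le_bound' ℂ _ _ _ hM fun x => ?_
  exact h i.1 (Finset.le_sup (f := Prod.fst) hi) i.2 (Finset.le_sup (f := Prod.snd) hi) x

lemma sum_choose_mul_le {n N : ℕ} (hn : n ≤ N) {f : ℕ → ℝ} {c : ℝ} (hc : 0 ≤ c)
    (h : ∀ i ≤ n, f i ≤ c) :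
    ∑ i ∈ Finset.range (n + 1), (n.choose i : ℝ) * f i ≤ 2 ^ N * c := by
  calc ∑ i ∈ Finset.range (n + 1), (n.choose i : ℝ) * f i
      ≤ ∑ i ∈ Finset.range (n + 1), (n.choose i : ℝ) * c := by
        gcongr with i hi
        exact h i (by simpa [Nat.lt_succ_iff] using hi)
    _ = 2 ^ n * c := by
        rw [← Finset.sum_mul]
        congr 1
        exact_mod_cast Nat.sum_range_choose n
    _ ≤ 2 ^ N * c := by gcongr; norm_num

lemma norm_iteratedDeriv_scaledBump_le {n : ℕ} {B : ℝ}
    (hB : ∀ j ≤ n, ∀ x, ‖iteratedDeriv j unitBump x‖ ≤ B) (c : ℝ) {r : ℝ} (hr : 0 < r)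
    {j : ℕ} (hj : j ≤ n) (x : ℝ) : ‖iteratedDeriv j (scaledBump c r) x‖ ≤ r⁻¹ ^ j * B := by
  rw [iteratedDeriv_scaledBump, norm_smul, norm_pow, Real.norm_eq_abs, abs_of_pos (inv_pos.mpr hr)]
  gcongr
  exact hB j hj _

/-- Compactly supported functions are dense in the Schwartz space. -/
lemma apply_eq_zero_of_forall_hasCompactSupport (u : 𝓢'(ℝ, ℂ))
    (h : ∀ φ : 𝓢(ℝ, ℂ), HasCompactSupport φ → u φ = 0) (φ : 𝓢(ℝ, ℂ)) : u φ = 0 := by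
  obtain ⟨K, N, C, hC, hu⟩ := exists_order u
  obtain ⟨B, hB0, hB⟩ := exists_bound_iteratedDeriv_unitBump N
  set S : ℝ := ∑ k ∈ Finset.range (K + 1), ∑ n ∈ Finset.range (N + 1),
    SchwartzMap.seminorm ℂ (k + 1) n φ with hS
  have hS0 : 0 ≤ S := Finset.sum_nonneg fun k _ => Finset.sum_nonneg fun n _ => apply_nonneg _ _
  -- One spare power of `|x|`: the error `(1 - scaledBump 0 r) φ` lives on `|x| ≥ r / 2`, where this
  -- power yields the factor `2 / r`.
  have hle : ∀ k ≤ K, ∀ n ≤ N, ∀ x, |x| ^ (k + 1) * ‖iteratedDeriv n φ x‖ ≤ S := by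
    intro k hk n hn x
    refine (SchwartzMap.le_seminorm' ℂ (k + 1) n φ x).trans ?_
    refine le_trans ?_ (Finset.single_le_sum
      (f := fun k => ∑ n ∈ Finset.range (N + 1), SchwartzMap.seminorm ℂ (k + 1) n φ)
      (fun k _ => Finset.sum_nonneg fun n _ => apply_nonneg _ _)
      (Finset.mem_range.mpr (Nat.lt_succ_of_le hk)))
    exact Finset.single_le_sum (f := fun n => SchwartzMap.seminorm ℂ (k + 1) n φ)
      (fun n _ => apply_nonneg _ _) (Finset.mem_range.mpr (Nat.lt_succ_of_le hn))
  have key : ∀ r : ℝ, 1 ≤ r → ‖u φ‖ ≤ C * (2 ^ N * ((1 + B) * (2 * S))) * r⁻¹ := by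
    intro r hr
    have hr0 : 0 < r := by linarith
    set ψ := SchwartzMap.smulLeftCLM ℂ (scaledBump 0 r) φ with hψ
    have hψa : ∀ x, ψ x = scaledBump 0 r x * φ x := fun x => by
      rw [hψ, SchwartzMap.smulLeftCLM_apply_apply (hasTemperateGrowth_scaledBump hr0), smul_eq_mul]
    have h0 : u ψ = 0 := h _ (by
      refine (hasCompactSupport_scaledBump (c := 0) hr0).mono fun x hx hx' => hx ?_
      rw [hψa, hx', zero_mul])
    have e1 : ((φ - ψ : 𝓢(ℝ, ℂ)) : ℝ → ℂ) = fun x => (1 - scaledBump 0 r x) * φ x := by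
      funext x
      rw [sub_apply, hψa]; ring
    have hg : ContDiff ℝ ∞ (fun x => 1 - scaledBump 0 r x) :=
      contDiff_const.sub (contDiff_scaledBump 0 r)
    have hgB : ∀ i ≤ N, ∀ x, ‖iteratedDeriv i (fun x => 1 - scaledBump 0 r x) x‖ ≤ 1 + B := by
      intro i hi x
      rw [iteratedDeriv_fun_sub contDiffAt_const
        ((contDiff_scaledBump 0 r).of_le (by exact_mod_cast le_top)).contDiffAt]
      refine (norm_sub_le _ _).trans (add_le_add ?_ ?_)
      · rw [iteratedDeriv_const]; split_ifs <;> simp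
      · refine (norm_iteratedDeriv_scaledBump_le hB 0 hr0 hi x).trans ?_
        have : r⁻¹ ^ i ≤ 1 := pow_le_one₀ (inv_nonneg.mpr hr0.le) (inv_le_one_of_one_le₀ hr)
        nlinarith
    have := hu (φ - ψ) (2 ^ N * ((1 + B) * (2 * S)) * r⁻¹) (by positivity) (by
      intro k hk n hn x
      rw [e1]
      by_cases hx : |x| < r / 2
      · have : (fun x => (1 - scaledBump 0 r x) * φ x) =ᶠ[𝓝 x] 0 := by
          filter_upwards [(isOpen_lt continuous_abs continuous_const).mem_nhds hx] with y hy
          rw [scaledBump_eq_one hr0 (by simpa using le_of_lt hy)]; simp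
        rw [this.iteratedDeriv_eq]
        simp only [Pi.zero_def, iteratedDeriv_fun_const_zero, norm_zero, mul_zero]
        positivity
      · push Not at hx
        have hk1 : ∀ m ≤ N, |x| ^ k * ‖iteratedDeriv m φ x‖ ≤ 2 * S * r⁻¹ := by
          intro m hm
          have h1 := hle k hk m hm x
          rw [pow_succ] at h1
          rw [← div_eq_mul_inv, le_div_iff₀ hr0]
          have h2 : 0 ≤ |x| ^ k * ‖iteratedDeriv m φ x‖ := by positivity
          nlinarith
        have h3 := norm_iteratedDeriv_mul_le hg (φ.smooth ⊤) n x
        refine (mul_le_mul_of_nonneg_left h3 (by positivity)).trans ?_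
        rw [Finset.mul_sum]
        have h4 := sum_choose_mul_le hn (f := fun i => ‖iteratedDeriv i
          (fun x => 1 - scaledBump 0 r x) x‖ * (|x| ^ k * ‖iteratedDeriv (n - i) φ x‖))
          (c := (1 + B) * (2 * S * r⁻¹)) (by positivity) (fun i hi =>
            mul_le_mul (hgB i (hi.trans hn) x) (hk1 _ (by omega)) (by positivity) (by positivity))
        refine le_trans (le_of_eq ?_) (h4.trans (le_of_eq (by ring)))
        refine Finset.sum_congr rfl fun i _ => by ring)
    rw [map_sub, h0, sub_zero] at this
    linarith
  have hlim : Filter.Tendsto (fun r : ℝ => C * (2 ^ N * ((1 + B) * (2 * S))) * r⁻¹) Filter.atTop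
      (𝓝 (C * (2 ^ N * ((1 + B) * (2 * S))) * 0)) :=
    tendsto_inv_atTop_zero.const_mul _
  rw [mul_zero] at hlim
  have := ge_of_tendsto hlim (Filter.eventually_atTop.mpr ⟨1, key⟩)
  exact norm_le_zero_iff.mp this

/-- Localising near a point where `φ` vanishes to high order makes the pairing small. -/
lemma exists_vanishing_order_local (u : 𝓢'(ℝ, ℂ)) : ∃ m : ℕ, ∀ (φ : 𝓢(ℝ, ℂ)) (c : ℝ),
    VanishesToOrder m φ c → ∃ A : ℝ, ∀ r : ℝ, 0 < r → r ≤ 1 →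
      ‖u (SchwartzMap.smulLeftCLM ℂ (scaledBump c r) φ)‖ ≤ A * r := by
  obtain ⟨K, N, C, hC, hu⟩ := exists_order u
  obtain ⟨B, hB0, hB⟩ := exists_bound_iteratedDeriv_unitBump N
  -- In a Leibniz term of order `n ≤ N`, the bump costs `r⁻¹ ^ i` and the factor of `φ` gives at
  -- least `r ^ (i + 1)`, leaving one power of `r`.
  refine ⟨N + 1, fun φ c hφ => ?_⟩
  have hT : ∀ i, ∃ D, 0 ≤ D ∧ ∀ y, |y - c| ≤ 1 →
      ‖iteratedDeriv i φ y‖ ≤ D * |y - c| ^ (N + 1 - i) := fun i => by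
    refine VanishesToOrder.exists_bound ?_ ?_
    · rw [iteratedDeriv_eq_iterate]
      exact (φ.smooth ⊤).iterate_deriv i
    · intro j hj
      have : iteratedDeriv j (iteratedDeriv i φ) c = iteratedDeriv (j + i) φ c := by
        simp only [iteratedDeriv_eq_iterate, ← Function.iterate_add_apply]
      rw [this]
      exact hφ _ (by omega)
  choose D hD0 hD using hT
  set E := ∑ i ∈ Finset.range (N + 1), D i with hE
  have hE0 : 0 ≤ E := Finset.sum_nonneg fun i _ => hD0 i
  have hDE : ∀ i ≤ N, D i ≤ E := fun i hi =>
    Finset.single_le_sum (f := D) (fun i _ => hD0 i) (Finset.mem_range.mpr (Nat.lt_succ_of_le hi))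
  refine ⟨C * ((|c| + 1) ^ K * (2 ^ N * (B * E))), fun r hr0 hr1 => ?_⟩
  have hψa : (SchwartzMap.smulLeftCLM ℂ (scaledBump c r) φ : ℝ → ℂ) =
      fun x => scaledBump c r x * φ x := funext fun x => by
    rw [SchwartzMap.smulLeftCLM_apply_apply (hasTemperateGrowth_scaledBump hr0), smul_eq_mul]
  rw [mul_assoc]
  refine hu _ _ (by positivity) fun k hk n hn x => ?_
  rw [hψa]
  by_cases hx : |x - c| ≤ r
  · have hxk : |x| ^ k ≤ (|c| + 1) ^ K := by
      have h1 : |x| ≤ |c| + 1 := by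
        have := abs_add_le (x - c) c
        rw [sub_add_cancel] at this
        linarith
      exact (pow_le_pow_left₀ (abs_nonneg _) h1 k).trans
        (pow_le_pow_right₀ (by linarith [abs_nonneg c]) hk)
    have h3 := norm_iteratedDeriv_mul_le (contDiff_scaledBump c r) (φ.smooth ⊤) n x
    have h4 := sum_choose_mul_le hn (f := fun i => ‖iteratedDeriv i (scaledBump c r) x‖ *
      ‖iteratedDeriv (n - i) φ x‖) (c := B * E * r) (by positivity) (fun i hi => by
        have h5 := norm_iteratedDeriv_scaledBump_le hB c hr0 (hi.trans hn) x
        have h6 : ‖iteratedDeriv (n - i) φ x‖ ≤ E * r ^ (i + 1) := by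
          refine (hD (n - i) x (hx.trans hr1)).trans ?_
          refine mul_le_mul (hDE _ (by omega)) ?_ (by positivity) hE0
          refine (pow_le_pow_left₀ (abs_nonneg _) hx _).trans ?_
          exact pow_le_pow_of_le_one hr0.le hr1 (by omega)
        refine (mul_le_mul h5 h6 (norm_nonneg _) (by positivity)).trans (le_of_eq ?_)
        rw [pow_succ, inv_pow]
        field_simp)
    refine (mul_le_mul hxk h3 (norm_nonneg _) (by positivity)).trans ?_
    rw [mul_assoc]
    refine mul_le_mul_of_nonneg_left ?_ (by positivity)
    refine le_trans (le_of_eq ?_) (h4.trans (le_of_eq (by ring)))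
    exact Finset.sum_congr rfl fun i _ => by ring
  · have : x ∉ tsupport (fun x => scaledBump c r x * φ x) := fun hx' => hx (by
      simpa [Real.dist_eq] using
        tsupport_scaledBump_subset hr0 (tsupport_mul_subset_left hx'))
    rw [iteratedDeriv_eq_zero_of_notMem_tsupport this, norm_zero, mul_zero]
    positivity

/-- A partition of unity on `tsupport φ`, subordinate to open sets where `u` vanishes, splits `φ`
into finitely many pieces, each killed by `u`. -/
lemma apply_eq_zero_of_disjoint_dsupport (u : 𝓢'(ℝ, ℂ)) (φ : 𝓢(ℝ, ℂ)) (hφ : HasCompactSupport φ)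
    (h : Disjoint (dsupport u) (tsupport φ)) : u φ = 0 := by
  have h1 : ∀ x : tsupport φ, ∃ s : Set ℝ, IsVanishingOn u s ∧ IsOpen s ∧ (x : ℝ) ∈ s := fun x =>
    (notMem_dsupport_iff (x : ℝ)).mp fun hx => Set.disjoint_left.mp h hx x.2
  choose V hV hVo hxV using h1
  obtain ⟨f, hf⟩ := SmoothPartitionOfUnity.exists_isSubordinate 𝓘(ℝ, ℝ) (isClosed_tsupport φ) V hVo
    (fun x hx => Set.mem_iUnion.mpr ⟨⟨x, hx⟩, hxV _⟩)
  have hfin := f.locallyFinite.finite_nonempty_inter_compact hφ.isCompact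
  have hsm : ∀ i, ContDiff ℝ ∞ (fun x => ((f i x : ℝ) : ℂ) * φ x) := fun i =>
    (Complex.ofRealCLM.contDiff.comp (f i).contMDiff.contDiff).mul (φ.smooth ⊤)
  have hcs : ∀ i, HasCompactSupport (fun x => ((f i x : ℝ) : ℂ) * φ x) := fun i => hφ.mul_left
  have e : φ = ∑ i ∈ hfin.toFinset, (hcs i).toSchwartzMap (hsm i) := by
    ext x
    rw [sum_apply]
    change φ x = ∑ i ∈ hfin.toFinset, ((f i x : ℝ) : ℂ) * φ x
    rw [← Finset.sum_mul]
    by_cases hx : x ∈ tsupport φ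
    · have h2 := f.sum_eq_one hx
      rw [finsum_eq_sum_of_support_subset (s := hfin.toFinset) _ (fun i hi => by
        simp only [Set.Finite.coe_toFinset, Set.mem_ofPred_eq]
        exact ⟨x, hi, hx⟩)] at h2
      rw [← Complex.ofReal_sum, h2]; simp
    · rw [image_eq_zero_of_notMem_tsupport hx, mul_zero]
  rw [e, map_sum]
  refine Finset.sum_eq_zero fun i _ => hV i _ ?_
  refine subset_trans ?_ (hf i)
  refine closure_mono fun x hx hx' => hx ?_
  change ((f i x : ℝ) : ℂ) * φ x = 0
  simp [hx']

/-- A tempered distribution annihilates every compactly supported test function which vanishes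
to a suitable fixed order at the points of its support, if only finitely many of these are in the
support of the test function. -/
lemma exists_vanishing_order (u : 𝓢'(ℝ, ℂ)) : ∃ m : ℕ, ∀ φ : 𝓢(ℝ, ℂ), HasCompactSupport φ →
    (dsupport u ∩ tsupport φ).Finite → (∀ c ∈ dsupport u, VanishesToOrder m φ c) → u φ = 0 := by
  obtain ⟨m, hm⟩ := exists_vanishing_order_local u
  refine ⟨m, fun φ hφ hfin hv => ?_⟩
  -- Induction on the number of support points met: cutting out a ball around `c` leaves fewer of
  -- them, so `u φ` equals the local contribution at `c`, which tends to `0` with the radius.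
  induction hn : (dsupport u ∩ tsupport φ).ncard using Nat.strong_induction_on generalizing φ with
  | _ n ih =>
    rcases (dsupport u ∩ tsupport φ).eq_empty_or_nonempty with h0 | ⟨c, hc⟩
    · exact apply_eq_zero_of_disjoint_dsupport u φ hφ (Set.disjoint_iff_inter_eq_empty.mpr h0)
    · obtain ⟨A, hA⟩ := hm φ c (hv c hc.1)
      have key : ∀ r : ℝ, 0 < r → r ≤ 1 → ‖u φ‖ ≤ A * r := by
        intro r hr0 hr1
        set ψ := SchwartzMap.smulLeftCLM ℂ (scaledBump c r) φ with hψ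
        have e1 : ((φ - ψ : 𝓢(ℝ, ℂ)) : ℝ → ℂ) = fun x => (1 - scaledBump c r x) * φ x := by
          funext x
          rw [sub_apply, hψ, SchwartzMap.smulLeftCLM_apply_apply
            (hasTemperateGrowth_scaledBump hr0), smul_eq_mul]
          ring
        have hsub : tsupport (φ - ψ : 𝓢(ℝ, ℂ)) ⊆ tsupport φ := by
          rw [e1]; exact tsupport_mul_subset_right
        have hc' : c ∉ tsupport (φ - ψ : 𝓢(ℝ, ℂ)) := by
          rw [notMem_tsupport_iff_eventuallyEq, e1]
          filter_upwards [Metric.closedBall_mem_nhds c (half_pos hr0)] with y hy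
          rw [scaledBump_eq_one hr0 (by simpa [Real.dist_eq] using hy)]
          simp
        have h0 : u (φ - ψ) = 0 := by
          refine ih _ ?_ (φ - ψ) (hφ.of_isClosed_subset (isClosed_tsupport _) hsub)
            (hfin.subset (Set.inter_subset_inter_right _ hsub)) ?_ rfl
          · rw [← hn]
            refine Set.ncard_lt_ncard ⟨Set.inter_subset_inter_right _ hsub, fun h => ?_⟩ hfin
            exact hc' (h hc).2
          · intro d hd
            rw [e1]
            exact VanishesToOrder.mul_left (contDiff_const.sub (contDiff_scaledBump c r))
              (φ.smooth ⊤) (hv d hd)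
        rw [map_sub, sub_eq_zero] at h0
        rw [h0]
        exact hA r hr0 hr1
      have hlim : Filter.Tendsto (fun r : ℝ => A * r) (𝓝[>] 0) (𝓝 (A * 0)) :=
        (Filter.tendsto_id.const_mul A).mono_left nhdsWithin_le_nhds
      rw [mul_zero] at hlim
      refine norm_le_zero_iff.mp (ge_of_tendsto hlim ?_)
      filter_upwards [Ioc_mem_nhdsGT (zero_lt_one' ℝ)] with r hr
      exact key r hr.1 hr.2

end TemperedDistribution

/-! ### Locally finite sets, characters and trigonometric polynomials. -/

lemma IsLocallyFiniteSet.inter_isCompact_finite {S : Set ℝ} (hS : IsLocallyFiniteSet S) {K : Set ℝ}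
    (hK : IsCompact K) : (S ∩ K).Finite := by
  by_contra h
  obtain ⟨x, -, hx⟩ := Set.Infinite.exists_accPt_of_subset_isCompact h hK Set.inter_subset_right
  exact hS x (hx.mono (Filter.principal_mono.mpr Set.inter_subset_left))

lemma isLocallyFiniteSet_of_finite_inter {S : Set ℝ}
    (h : ∀ R : ℝ, (S ∩ Metric.closedBall 0 R).Finite) : IsLocallyFiniteSet S := by
  intro x hx
  rw [accPt_iff_nhds] at hx
  have hf := h (|x| + 1)
  have hc : ((S ∩ Metric.closedBall 0 (|x| + 1)) \ {x})ᶜ ∈ 𝓝 x :=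
    (hf.subset Set.sdiff_subset).isClosed.isOpen_compl.mem_nhds (by simp)
  obtain ⟨y, ⟨⟨hy1, hy2⟩, hyS⟩, hyx⟩ := hx _ (Filter.inter_mem hc (Metric.ball_mem_nhds x one_pos))
  refine hy1 ⟨⟨hyS, ?_⟩, hyx⟩
  rw [Metric.mem_ball, Real.dist_eq] at hy2
  rw [mem_closedBall_zero_iff, Real.norm_eq_abs]
  have := abs_add_le (y - x) x
  rw [sub_add_cancel] at this
  linarith

lemma isLocallyFiniteSet_of_subset_translates {S T : Set ℝ} (hT : T.Finite) {a : ℝ} (ha : 0 < a)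
    (h : ∀ x ∈ S, ∃ τ ∈ T, ∃ n : ℤ, x = τ + n * a) : IsLocallyFiniteSet S := by
  refine isLocallyFiniteSet_of_finite_inter fun R => ?_
  have hfin : ∀ τ ∈ T, ((fun n : ℤ => τ + n * a) ''
      Set.Icc ⌈(-R - τ) / a⌉ ⌊(R - τ) / a⌋).Finite := fun τ _ => (Set.finite_Icc _ _).image _
  refine (hT.biUnion hfin).subset fun x hx => ?_
  obtain ⟨τ, hτ, n, rfl⟩ := h x hx.1
  have hx2 := hx.2
  rw [mem_closedBall_zero_iff, Real.norm_eq_abs, abs_le] at hx2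
  refine Set.mem_iUnion₂.mpr ⟨τ, hτ, n, ⟨?_, ?_⟩, rfl⟩
  · rw [Int.ceil_le, div_le_iff₀ ha]; linarith [hx2.1]
  · rw [Int.le_floor, le_div_iff₀ ha]; linarith [hx2.2]

/-- The character `x ↦ exp (2 π i ν x)`. -/
noncomputable def wave (ν x : ℝ) : ℂ := Complex.exp (2 * Real.pi * Complex.I * ν * x)

lemma norm_wave (ν x : ℝ) : ‖wave ν x‖ = 1 := by
  rw [wave, show 2 * (Real.pi : ℂ) * Complex.I * ν * x = ((2 * Real.pi * ν * x : ℝ) : ℂ) * Complex.I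
    by push_cast; ring, Complex.norm_exp_ofReal_mul_I]

lemma wave_add (ν x y : ℝ) : wave ν (x + y) = wave ν x * wave ν y := by
  rw [wave, wave, wave, ← Complex.exp_add]; push_cast; ring_nf

lemma wave_eq_one {ν x : ℝ} {n : ℤ} (h : ν * x = n) : wave ν x = 1 := by
  rw [wave, mul_assoc, ← Complex.ofReal_mul, h, Complex.exp_eq_one_iff]
  exact ⟨n, by push_cast; ring⟩

lemma contDiff_wave (ν : ℝ) : ContDiff ℝ ∞ (wave ν) := by
  unfold wave
  exact Complex.contDiff_exp.comp (contDiff_const.mul Complex.ofRealCLM.contDiff)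

lemma iteratedDeriv_wave (ν : ℝ) (n : ℕ) :
    iteratedDeriv n (wave ν) = fun x => (2 * Real.pi * Complex.I * ν) ^ n * wave ν x := by
  induction n with
  | zero => simp
  | succ n ih =>
    rw [iteratedDeriv_succ, ih]
    funext x
    have h1 : HasDerivAt (fun y : ℝ => (2 * Real.pi * Complex.I * ν : ℂ) * y)
        (2 * Real.pi * Complex.I * ν * 1) x :=
      (Complex.ofRealCLM.hasDerivAt (x := x)).const_mul _
    have h2 := (h1.cexp.const_mul ((2 * Real.pi * Complex.I * ν) ^ n)).deriv
    unfold wave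
    rw [h2]; ring

lemma hasTemperateGrowth_wave (ν : ℝ) : (wave ν).HasTemperateGrowth := by
  refine ⟨contDiff_wave ν, fun n => ⟨0, ‖(2 * Real.pi * Complex.I * ν : ℂ)‖ ^ n, fun x => ?_⟩⟩
  rw [norm_iteratedFDeriv_eq_norm_iteratedDeriv, iteratedDeriv_wave, norm_mul, norm_pow, norm_wave]
  simp

/-- The trigonometric polynomial `∏ (exp (2 π i ν x) - z)` over `z ∈ s`. -/
noncomputable def wavePoly (ν : ℝ) (s : Multiset ℂ) (x : ℝ) : ℂ :=
  (s.map fun z => wave ν x - z).prod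

lemma wavePoly_cons (ν : ℝ) (z : ℂ) (s : Multiset ℂ) :
    wavePoly ν (z ::ₘ s) = fun x => (wave ν x - z) * wavePoly ν s x := by
  funext x; simp [wavePoly]

lemma hasTemperateGrowth_wavePoly (ν : ℝ) (s : Multiset ℂ) :
    (wavePoly ν s).HasTemperateGrowth := by
  induction s using Multiset.induction_on with
  | empty =>
    have : wavePoly ν 0 = fun _ => 1 := by funext x; simp [wavePoly]
    rw [this]; exact Function.HasTemperateGrowth.const 1
  | cons z s ih =>
    rw [wavePoly_cons]
    exact ((hasTemperateGrowth_wave ν).sub (Function.HasTemperateGrowth.const z)).mul ih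

lemma contDiff_wavePoly (ν : ℝ) (s : Multiset ℂ) : ContDiff ℝ ∞ (wavePoly ν s) :=
  (hasTemperateGrowth_wavePoly ν s).1

/-! ### From annihilating polynomials to recurrences, and from recurrences to cosets. -/

namespace TemperedDistribution

open Distribution

/-- Along such a family the index shift is multiplication by `wave ν`, so each factor `E - z`
becomes multiplication by `wave ν - z`. -/
lemma diffOp_apply_family (u : 𝓢'(ℝ, ℂ)) (ν : ℝ) (s : Multiset ℂ) (φ : ℤ → 𝓢(ℝ, ℂ))
    (hφ : ∀ j x, φ (j + 1) x = wave ν x * φ j x) :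
    diffOp s (fun j => u (φ j)) = fun j => u (SchwartzMap.smulLeftCLM ℂ (wavePoly ν s) (φ j)) := by
  induction s using Multiset.induction_on generalizing φ with
  | empty =>
    have h1 : wavePoly ν 0 = fun _ => 1 := by funext x; simp [wavePoly]
    simp [h1, SchwartzMap.smulLeftCLM_const]
  | cons z s ih =>
    rw [diffOp_cons_apply]
    have h1 : (fun n => u (φ (n + 1)) - z * u (φ n)) = fun n => u (φ (n + 1) - z • φ n) := by
      funext n
      rw [map_sub, map_smul, smul_eq_mul]
    rw [h1, ih (fun n => φ (n + 1) - z • φ n) (fun j x => by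
      simp only [sub_apply, smul_apply, smul_eq_mul, hφ]; ring)]
    funext j
    congr 1
    ext x
    rw [SchwartzMap.smulLeftCLM_apply_apply (hasTemperateGrowth_wavePoly ν s),
      SchwartzMap.smulLeftCLM_apply_apply (hasTemperateGrowth_wavePoly ν _), wavePoly_cons]
    simp only [sub_apply, smul_apply, smul_eq_mul, hφ]
    ring

/-- If `exp (2 π i ν x)` takes only finitely many values on the support of `u`, then `u` is
annihilated by a trigonometric polynomial. -/
lemma exists_diffOp_family_eq_zero (u : 𝓢'(ℝ, ℂ)) (ν : ℝ) (hloc : IsLocallyFiniteSet (dsupport u))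
    (Z : Finset ℂ) (hZ1 : ∀ z ∈ Z, ‖z‖ = 1) (hZ : ∀ x ∈ dsupport u, wave ν x ∈ Z) :
    ∃ s : Multiset ℂ, (∀ z ∈ s, ‖z‖ = 1) ∧ ∀ φ : ℤ → 𝓢(ℝ, ℂ),
      (∀ j x, φ (j + 1) x = wave ν x * φ j x) → diffOp s (fun j => u (φ j)) = 0 := by
  obtain ⟨m, hm⟩ := exists_vanishing_order u
  -- Each value is taken `m` times as a root, so that the polynomial vanishes to order `m` at every
  -- support point.
  refine ⟨m • Z.val, fun z hz => hZ1 z (Multiset.mem_of_mem_nsmul hz), fun φ hφ => ?_⟩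
  rw [diffOp_apply_family u ν _ φ hφ]
  funext j
  have hP := hasTemperateGrowth_wavePoly ν (m • Z.val)
  have hpow : wavePoly ν (m • Z.val) = fun x => wavePoly ν Z.val x ^ m := by
    funext x
    simp [wavePoly, Multiset.map_nsmul, Multiset.prod_nsmul]
  have hv : ∀ c ∈ dsupport u, VanishesToOrder m (wavePoly ν (m • Z.val)) c := by
    intro c hc
    rw [hpow]
    refine VanishesToOrder.pow (contDiff_wavePoly ν Z.val) ?_ m
    exact Multiset.prod_eq_zero (Multiset.mem_map.mpr ⟨wave ν c, hZ c hc, sub_self _⟩)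
  -- `φ j` need not have compact support, so density is applied to the product of `u` with the
  -- polynomial.
  refine apply_eq_zero_of_forall_hasCompactSupport
    (TemperedDistribution.smulLeftCLM ℂ (wavePoly ν (m • Z.val)) u) (fun ψ hψ => ?_) (φ j)
  rw [smulLeftCLM_apply_apply]
  have e : (SchwartzMap.smulLeftCLM ℂ (wavePoly ν (m • Z.val)) ψ : ℝ → ℂ) =
      fun x => wavePoly ν (m • Z.val) x * ψ x := by
    funext x
    rw [SchwartzMap.smulLeftCLM_apply_apply hP, smul_eq_mul]
  have hcs : HasCompactSupport (SchwartzMap.smulLeftCLM ℂ (wavePoly ν (m • Z.val)) ψ) := by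
    rw [e]; exact hψ.mul_left
  refine hm _ hcs (hloc.inter_isCompact_finite hcs.isCompact) fun c hc => ?_
  rw [e]
  simpa using (hv c hc).mul hP.1 (ψ.smooth ⊤) (vanishesToOrder_zero ψ c)

/-- If the translates of `u` by multiples of `b` satisfy a linear recurrence and the support of `u`
is locally finite, then it is contained in finitely many cosets of `b ℤ`. -/
lemma exists_finite_cosets (u : 𝓢'(ℝ, ℂ)) {b : ℝ} (hb : 0 < b)
    (hloc : IsLocallyFiniteSet (dsupport u)) (s : Multiset ℂ) (hs : ∀ z ∈ s, ‖z‖ = 1)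
    (hrec : ∀ ψ : 𝓢(ℝ, ℂ), diffOp s (fun j => u (ψ.compSubConstCLM ℂ (j * b))) = 0) :
    ∃ W : Set ℝ, W.Finite ∧ ∀ x ∈ dsupport u, ∃ w ∈ W, ∃ n : ℤ, x = w + n * b := by
  -- A coset with no support point in this interval has `s.card` consecutive points off the support,
  -- enough for the recurrence to exclude all of it.
  refine ⟨dsupport u ∩ Set.Icc 0 (s.card * b), hloc.inter_isCompact_finite isCompact_Icc,
    fun t ht => ?_⟩
  by_contra hcon
  push Not at hcon
  -- First index with `t + m b ≥ 0`; then `t + m b < b`, so the indices from `m` to `m + s.card - 1`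
  -- keep `t + j b` inside the interval.
  set m : ℤ := ⌈-t / b⌉ with hm
  have hm1 : 0 ≤ t + m * b := by
    have := Int.le_ceil (-t / b)
    rw [div_le_iff₀ hb] at this
    linarith
  have hm2 : t + m * b < b := by
    have := Int.ceil_lt_add_one (-t / b)
    rw [← sub_lt_iff_lt_add, lt_div_iff₀ hb] at this
    linarith
  have hout : ∀ j ∈ Finset.Ico m (m + s.card), ∃ V : Set ℝ, IsVanishingOn u V ∧ IsOpen V ∧
      t + j * b ∈ V := by
    intro j hj
    rw [Finset.mem_Ico] at hj
    rw [← notMem_dsupport_iff]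
    intro hj'
    refine hcon (t + j * b) ⟨hj', ?_, ?_⟩ (-j) (by push_cast; ring)
    · have : (m : ℝ) ≤ j := by exact_mod_cast hj.1
      nlinarith
    · have : (j : ℝ) + 1 ≤ m + s.card := by exact_mod_cast hj.2
      nlinarith
  choose! V hV hVo hVt using hout
  -- Test functions supported this close to `t` have their window translates inside the sets `V j`,
  -- so the pairings vanish on the window, hence also at index `0`.
  refine (notMem_dsupport_iff t).mpr ⟨⋂ j ∈ Finset.Ico m (m + s.card),
    (fun x => x + j * b) ⁻¹' V j, fun ψ hψ => ?_, ?_, ?_⟩ ht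
  · have h0 := eq_zero_of_diffOp_of_window (fun z hz => by
      rintro rfl; simpa using hs 0 hz) m (hrec ψ) (fun n hn1 hn2 => by
      have hn : n ∈ Finset.Ico m (m + s.card) := Finset.mem_Ico.mpr ⟨hn1, hn2⟩
      refine hV n hn _ fun x hx => ?_
      have h1 : x ∈ (fun y => y - n * b) ⁻¹' tsupport ψ :=
        tsupport_comp_subset_preimage ψ (f := fun y => y - n * b) (by fun_prop) hx
      have h2 := Set.mem_iInter₂.mp (hψ h1) n hn
      simpa using h2)
    simpa using congrFun h0 0
  · exact isOpen_biInter_finset fun j hj => (hVo j hj).preimage (by fun_prop)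
  · exact Set.mem_iInter₂.mpr fun j hj => hVt j hj

end TemperedDistribution

/-! ### Passing the recurrence through the Fourier transform. -/

lemma SchwartzMap.fourier_compSubConstCLM (φ : 𝓢(ℝ, ℂ)) (a t : ℝ) :
    (𝓕 (φ.compSubConstCLM ℂ a) : 𝓢(ℝ, ℂ)) t = wave (-a) t * (𝓕 φ : 𝓢(ℝ, ℂ)) t := by
  rw [SchwartzMap.fourier_coe, SchwartzMap.fourier_coe, Real.fourier_eq', Real.fourier_eq',
    ← MeasureTheory.integral_const_mul, ← MeasureTheory.integral_add_right_eq_self _ a]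
  refine MeasureTheory.integral_congr_ae (Filter.Eventually.of_forall fun v => ?_)
  simp only [SchwartzMap.compSubConstCLM_apply, add_sub_cancel_right, smul_eq_mul, wave]
  rw [← mul_assoc, ← Complex.exp_add]
  congr 2
  simp
  ring

lemma SchwartzMap.fourierInv_compSubConstCLM (φ : 𝓢(ℝ, ℂ)) (a t : ℝ) :
    (𝓕⁻ (φ.compSubConstCLM ℂ a) : 𝓢(ℝ, ℂ)) t = wave a t * (𝓕⁻ φ : 𝓢(ℝ, ℂ)) t := by
  rw [SchwartzMap.fourierInv_coe, SchwartzMap.fourierInv_coe, Real.fourierInv_eq',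
    Real.fourierInv_eq',
    ← MeasureTheory.integral_const_mul, ← MeasureTheory.integral_add_right_eq_self _ a]
  refine MeasureTheory.integral_congr_ae (Filter.Eventually.of_forall fun v => ?_)
  simp only [SchwartzMap.compSubConstCLM_apply, add_sub_cancel_right, smul_eq_mul, wave]
  rw [← mul_assoc, ← Complex.exp_add]
  congr 2
  simp
  ring

namespace TemperedDistribution

open Distribution

/-- For a tempered distribution with support in finitely many cosets of `a ℤ` and with locally
finite spectrum, the pairing with the translates of any test function by multiples of `a` satisfies
a fixed linear recurrence with unimodular characteristic roots. -/
theorem exists_diffOp_translates_eq_zero (α : 𝓢'(ℝ, ℂ)) {a : ℝ} (ha : 0 < a) {T : Set ℝ}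
    (hT : T.Finite) (hsupp : ∀ x ∈ dsupport α, ∃ τ ∈ T, ∃ n : ℤ, x = τ + n * a)
    (hspec : IsLocallyFiniteSet (dsupport (𝓕 α : 𝓢'(ℝ, ℂ)))) :
    ∃ s : Multiset ℂ, (∀ z ∈ s, ‖z‖ = 1) ∧
      ∀ φ : 𝓢(ℝ, ℂ), diffOp s (fun n => α (φ.compSubConstCLM ℂ (n * a))) = 0 := by
  -- When `ν b` is an integer, `wave ν` is constant on cosets of `b ℤ`, so it has finitely many
  -- values on the support. This is used for `α` and then for its transform.
  have key : ∀ (u : 𝓢'(ℝ, ℂ)) (ν b : ℝ) (_ : IsLocallyFiniteSet (dsupport u))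
      (k : ℤ) (_ : ν * b = k) (W : Set ℝ) (_ : W.Finite)
      (_ : ∀ x ∈ dsupport u, ∃ w ∈ W, ∃ n : ℤ, x = w + n * b),
      ∃ s : Multiset ℂ, (∀ z ∈ s, ‖z‖ = 1) ∧ ∀ φ : ℤ → 𝓢(ℝ, ℂ),
        (∀ j x, φ (j + 1) x = wave ν x * φ j x) → diffOp s (fun j => u (φ j)) = 0 := by
    intro u ν b hloc k hνb W hW hsub
    refine exists_diffOp_family_eq_zero u ν hloc (hW.image (wave ν)).toFinset ?_ ?_
    · intro z hz
      obtain ⟨x, -, rfl⟩ := (Set.Finite.mem_toFinset _).mp hz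
      exact norm_wave ν x
    · intro x hx
      obtain ⟨w, hw, n, rfl⟩ := hsub x hx
      refine (Set.Finite.mem_toFinset _).mpr ⟨w, hw, ?_⟩
      rw [wave_add, wave_eq_one (x := n * b) (n := k * n), mul_one]
      push_cast
      rw [← hνb]; ring
  -- The sign is that of the forward transform: translation by `a⁻¹` becomes multiplication by `wave
  -- (-a⁻¹)`.
  obtain ⟨s, hs, hrec⟩ := key α (-a⁻¹) a (isLocallyFiniteSet_of_subset_translates hT ha hsupp) (-1)
    (by field_simp; norm_num) T hT hsupp
  obtain ⟨W, hW, hsub⟩ := exists_finite_cosets (𝓕 α) (inv_pos.mpr ha) hspec s hs (fun ψ => by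
    refine hrec (fun j => 𝓕 (ψ.compSubConstCLM ℂ (j * a⁻¹))) fun j x => ?_
    rw [← SchwartzMap.fourier_compSubConstCLM, SchwartzMap.compSubConstCLM_comp]
    push_cast
    rw [add_mul, one_mul])
  obtain ⟨s', hs', hrec'⟩ := key (𝓕 α) a a⁻¹ hspec 1 (by field_simp; norm_num) W hW hsub
  refine ⟨s', hs', fun φ => ?_⟩
  have := hrec' (fun n => 𝓕⁻ (φ.compSubConstCLM ℂ (n * a))) fun j x => by
    rw [← SchwartzMap.fourierInv_compSubConstCLM, SchwartzMap.compSubConstCLM_comp]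
    push_cast
    rw [add_mul, one_mul]
  simpa [TemperedDistribution.fourier_apply] using this

end TemperedDistribution

/-! ### Local structure: expansion in derivatives of point masses. -/

lemma SchwartzMap.derivCLM_pow_apply (φ : 𝓢(ℝ, ℂ)) (j : ℕ) (x : ℝ) :
    ((SchwartzMap.derivCLM ℂ ℂ) ^ j) φ x = iteratedDeriv j φ x := by
  induction j generalizing x with
  | zero => simp
  | succ j ih =>
    rw [pow_succ', mul_apply_eq_comp, SchwartzMap.derivCLM_apply, iteratedDeriv_succ]
    congr 1
    exact funext ih

lemma iteratedDeriv_ofReal_pow (p j : ℕ) : iteratedDeriv j (fun x : ℝ => (x : ℂ) ^ p) =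
    fun x : ℝ => (p.descFactorial j : ℂ) * (x : ℂ) ^ (p - j) := by
  induction j with
  | zero => simp
  | succ j ih =>
    rw [iteratedDeriv_succ, ih]
    funext x
    have h1 : HasDerivAt (fun y : ℝ => (y : ℂ)) 1 x := Complex.ofRealCLM.hasDerivAt (x := x)
    rw [((h1.fun_pow (p - j)).const_mul _).deriv, Nat.descFactorial_succ, Nat.sub_sub]
    push_cast
    ring

/-- A test function supported near `0` whose Taylor coefficients at `0` vanish except the `p`-th. -/
noncomputable def jetBump {r : ℝ} (hr : 0 < r) (p : ℕ) : 𝓢(ℝ, ℂ) :=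
  HasCompactSupport.toSchwartzMap (f := fun x => scaledBump 0 r x * ((x : ℂ) ^ p / (p.factorial : ℂ)))
    (hasCompactSupport_scaledBump hr).mul_right
    ((contDiff_scaledBump 0 r).mul ((Complex.ofRealCLM.contDiff.pow p).div_const _))

lemma jetBump_apply {r : ℝ} (hr : 0 < r) (p : ℕ) (x : ℝ) :
    jetBump hr p x = scaledBump 0 r x * ((x : ℂ) ^ p / (p.factorial : ℂ)) := rfl

lemma iteratedDeriv_jetBump_zero {r : ℝ} (hr : 0 < r) (p j : ℕ) :
    iteratedDeriv j (jetBump hr p) 0 = if j = p then 1 else 0 := by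
  have h1 : (jetBump hr p : ℝ → ℂ) =ᶠ[𝓝 0] fun x => (p.factorial : ℂ)⁻¹ * (x : ℂ) ^ p := by
    filter_upwards [Metric.closedBall_mem_nhds (0 : ℝ) (half_pos hr)] with y hy
    rw [jetBump_apply, scaledBump_eq_one hr (by simpa [Real.dist_eq] using hy)]
    ring
  rw [h1.iteratedDeriv_eq, iteratedDeriv_const_mul_field, iteratedDeriv_ofReal_pow]
  rcases lt_trichotomy j p with h | rfl | h
  · simp [h.ne, Nat.sub_ne_zero_of_lt h]
  · have : (j.factorial : ℂ) ≠ 0 := by exact_mod_cast j.factorial_ne_zero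
    simp [Nat.descFactorial_self, this]
  · simp [h.ne', Nat.descFactorial_of_lt h]

lemma tsupport_jetBump_subset {r : ℝ} (hr : 0 < r) (p : ℕ) :
    tsupport (jetBump hr p) ⊆ Metric.closedBall 0 r :=
  tsupport_mul_subset_left.trans (tsupport_scaledBump_subset hr)

lemma iteratedDeriv_jetBump_of_lt {r : ℝ} (hr : 0 < r) (p j : ℕ) {x : ℝ} (hx : r < |x|) :
    iteratedDeriv j (jetBump hr p) x = 0 :=
  iteratedDeriv_eq_zero_of_notMem_tsupport (fun h => by
    have := tsupport_jetBump_subset hr p h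
    simp at this
    linarith) j

namespace TemperedDistribution

open Distribution

/-- A tempered distribution supported on a uniformly separated set is a combination of derivatives
of point masses, of bounded order. -/
lemma exists_apply_eq_sum_jets (u : 𝓢'(ℝ, ℂ)) (hloc : IsLocallyFiniteSet (dsupport u)) :
    ∃ m : ℕ, ∀ {ι : Type} (pt : ι → ℝ) {r : ℝ} (hr : 0 < r) (_ : dsupport u ⊆ Set.range pt)
      (_ : ∀ i j, i ≠ j → r < |pt i - pt j|) (φ : 𝓢(ℝ, ℂ)) (_ : HasCompactSupport φ)
      (G : Finset ι) (_ : ∀ i, pt i ∈ tsupport φ → i ∈ G),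
      u φ = ∑ i ∈ G, ∑ p ∈ Finset.range m,
        iteratedDeriv p φ (pt i) * u ((jetBump hr p).compSubConstCLM ℂ (pt i)) := by
  classical
  obtain ⟨m, hm⟩ := exists_vanishing_order u
  refine ⟨m, fun {ι} pt r hr hsub hsep φ hφ G hG => ?_⟩
  -- `χ` has the same derivatives of order below `m` as `φ` at every support point, so `u` does not
  -- distinguish them.
  set χ : 𝓢(ℝ, ℂ) := ∑ i ∈ G, ∑ p ∈ Finset.range m,
    iteratedDeriv p φ (pt i) • (jetBump hr p).compSubConstCLM ℂ (pt i) with hχ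
  have hu : u χ = ∑ i ∈ G, ∑ p ∈ Finset.range m,
      iteratedDeriv p φ (pt i) * u ((jetBump hr p).compSubConstCLM ℂ (pt i)) := by
    simp only [hχ, map_sum, map_smul, smul_eq_mul]
  rw [← hu, ← sub_eq_zero, ← map_sub]
  have hcs : HasCompactSupport (φ - χ : 𝓢(ℝ, ℂ)) := by
    refine HasCompactSupport.intro (hφ.isCompact.union
      (G.isCompact_biUnion fun i _ => isCompact_closedBall (pt i) r)) fun x hx => ?_
    rw [Set.mem_union, not_or, Set.mem_iUnion₂] at hx
    push Not at hx
    rw [sub_apply, image_eq_zero_of_notMem_tsupport hx.1, zero_sub, neg_eq_zero, hχ]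
    simp only [sum_apply, smul_apply, SchwartzMap.compSubConstCLM_apply]
    refine Finset.sum_eq_zero fun i hi => Finset.sum_eq_zero fun p _ => ?_
    have h0 : jetBump hr p (x - pt i) = 0 := image_eq_zero_of_notMem_tsupport fun h => hx.2 i hi (by
      have := tsupport_jetBump_subset hr p h
      simpa [Real.dist_eq] using this)
    rw [h0, smul_zero]
  refine hm _ hcs (hloc.inter_isCompact_finite hcs.isCompact) fun c hc j hj => ?_
  obtain ⟨i₀, rfl⟩ := hsub hc
  rw [← SchwartzMap.derivCLM_pow_apply, map_sub, sub_apply, sub_eq_zero, hχ]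
  simp only [map_sum, map_smul, sum_apply, smul_apply, SchwartzMap.derivCLM_pow_apply, smul_eq_mul]
  have hshift : ∀ i p, iteratedDeriv j ((jetBump hr p).compSubConstCLM ℂ (pt i)) (pt i₀) =
      iteratedDeriv j (jetBump hr p) (pt i₀ - pt i) := fun i p =>
    congrFun (iteratedDeriv_comp_sub_const j (jetBump hr p) (pt i)) (pt i₀)
  simp only [hshift]
  -- Separation by more than `r` keeps `pt i₀` off the bumps centred at the other points.
  have hterm : ∀ i ∈ G, ∑ p ∈ Finset.range m, iteratedDeriv p φ (pt i) *
      iteratedDeriv j (jetBump hr p) (pt i₀ - pt i) =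
      if i₀ = i then iteratedDeriv j φ (pt i₀) else 0 := by
    intro i _
    split_ifs with h
    · subst h
      simp [iteratedDeriv_jetBump_zero, hj]
    · exact Finset.sum_eq_zero fun p _ => by
        rw [iteratedDeriv_jetBump_of_lt hr p j (hsep i₀ i h), mul_zero]
  rw [Finset.sum_congr rfl hterm, Finset.sum_ite_eq]
  split_ifs with h
  · rfl
  · exact iteratedDeriv_eq_zero_of_notMem_tsupport (fun h' => h (hG i₀ h')) j

end TemperedDistribution

/-! ### Convergence of the series of point masses. -/

lemma deltaDeriv_apply (p : ℕ) (x : ℝ) (φ : 𝓢(ℝ, ℂ)) :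
    deltaDeriv p x φ = (-1) ^ p * iteratedDeriv p φ x := by
  have key : ∀ (u : 𝓢'(ℝ, ℂ)) (φ : 𝓢(ℝ, ℂ)), ((TemperedDistribution.derivCLM ℂ)^[p] u) φ =
      (-1) ^ p * u (((SchwartzMap.derivCLM ℂ ℂ) ^ p) φ) := by
    induction p with
    | zero => simp
    | succ p ih =>
      intro u φ
      rw [Function.iterate_succ_apply, ih, TemperedDistribution.derivCLM_apply_apply, map_neg,
        pow_succ' (SchwartzMap.derivCLM ℂ ℂ), mul_apply_eq_comp]
      ring
  rw [deltaDeriv, key, TemperedDistribution.delta_apply, SchwartzMap.derivCLM_pow_apply]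

lemma poissonTerm_apply (τ θ : ℝ) (l p : ℕ) (a : ℝ) (n : ℤ) (φ : 𝓢(ℝ, ℂ)) :
    poissonTerm τ θ l p (a * n) φ =
      expMonomial a θ l n * ((-1) ^ p * iteratedDeriv p φ (a * n + τ)) := by
  rw [poissonTerm, smul_apply, deltaDeriv_apply, smul_eq_mul, expMonomial]

lemma norm_expMonomial (a θ : ℝ) (l : ℕ) (n : ℤ) : ‖expMonomial a θ l n‖ = |a * n| ^ l := by
  have h := norm_wave θ (a * n)
  rw [wave, mul_right_comm] at h
  rw [expMonomial, norm_mul, h, mul_one, norm_pow, Complex.norm_real, Real.norm_eq_abs]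

/-- Pointwise sums exist by comparison; the same finite family of seminorms serving for all `i`
makes the sum continuous, hence a limit among tempered distributions. -/
lemma TemperedDistribution.summable_of_bound {ι : Type*} (f : ι → 𝓢'(ℝ, ℂ)) {g : ι → ℝ}
    (hg : Summable g) (s : Finset (ℕ × ℕ))
    (hf : ∀ i φ, ‖f i φ‖ ≤ g i * s.sup (schwartzSeminormFamily ℂ ℝ ℂ) φ) : Summable f := by
  have hsum : ∀ φ, Summable fun i => f i φ := fun φ =>
    Summable.of_norm_bounded (hg.mul_right _) fun i => hf i φ
  let v : 𝓢(ℝ, ℂ) →L[ℂ] ℂ := SchwartzMap.mkCLMtoNormedSpace (𝕜 := ℂ) (fun φ => ∑' i, f i φ)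
    (fun φ ψ => by simp only [map_add]; exact (hsum φ).tsum_add (hsum ψ))
    (fun c φ => by simp only [map_smul, RingHom.id_apply, smul_eq_mul]; exact tsum_mul_left)
    ⟨s, |∑' i, g i|, abs_nonneg _, fun φ => by
      refine (tsum_of_norm_bounded (hg.mul_right _).hasSum fun i => hf i φ).trans ?_
      rw [tsum_mul_right]
      gcongr
      exact le_abs_self _⟩
  refine ⟨ContinuousLinearMap.toPointwiseConvergenceCLM _ _ _ _ v, ?_⟩
  refine PointwiseConvergenceCLM.tendsto_iff_forall_tendsto.mpr fun φ => ?_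
  have := (hsum φ).hasSum
  refine Filter.Tendsto.congr (fun t => ?_) this
  rw [sum_apply]

lemma summable_one_add_mul_abs_inv_sq {a : ℝ} (ha : 0 < a) :
    Summable fun n : ℤ => ((1 + |a * n|) ^ 2)⁻¹ := by
  have h1 : Summable fun n : ℤ => a⁻¹ ^ 2 * (1 / (n : ℝ) ^ 2) :=
    (Real.summable_one_div_int_pow.mpr one_lt_two).mul_left _
  refine h1.of_norm_bounded_eventually ?_
  filter_upwards [(Set.finite_singleton (0 : ℤ)).compl_mem_cofinite] with n hn
  have hn0 : (n : ℝ) ≠ 0 := by exact_mod_cast hn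
  rw [Real.norm_eq_abs, abs_of_nonneg (by positivity), one_div, inv_pow, ← mul_inv, ← mul_pow]
  have h2 : 0 < (a * n) ^ 2 := by positivity
  refine inv_anti₀ h2 ?_
  rw [← sq_abs (a * n)]
  exact pow_le_pow_left₀ (abs_nonneg _) (by linarith) 2

/-- Decay of order `l + 2` of the test function absorbs the growth `|y| ^ l` and leaves the summable
weight `(1 + |y|) ^ (-2)`. -/
lemma summable_poissonTerm {a : ℝ} (ha : 0 < a) (τ θ : ℝ) (l p : ℕ) :
    Summable fun n : ℤ => poissonTerm τ θ l p (a * n) := by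
  refine TemperedDistribution.summable_of_bound _
    ((summable_one_add_mul_abs_inv_sq ha).mul_right ((1 + |τ|) ^ (l + 2) * 2 ^ (l + 2)))
    (Finset.Iic (l + 2, p)) fun n φ => ?_
  set y := a * n with hy
  have h1 := SchwartzMap.one_add_le_sup_seminorm_apply (𝕜 := ℂ) (m := (l + 2, p)) le_rfl le_rfl φ
    (y + τ)
  rw [norm_iteratedFDeriv_eq_norm_iteratedDeriv, Real.norm_eq_abs] at h1
  rw [poissonTerm_apply, norm_mul, norm_mul, norm_pow, norm_neg, norm_one, one_pow, one_mul,
    norm_expMonomial, ← hy]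
  rw [mul_assoc, inv_mul_eq_div, le_div_iff₀ (by positivity)]
  -- Transfers decay from the point `y + τ` to `y`.
  have h2 : 1 + |y| ≤ (1 + |τ|) * (1 + |y + τ|) := by
    have := abs_sub (y + τ) τ
    rw [add_sub_cancel_right] at this
    nlinarith [abs_nonneg τ, abs_nonneg (y + τ)]
  have h3 : |y| ^ l * (1 + |y|) ^ 2 ≤ (1 + |τ|) ^ (l + 2) * (1 + |y + τ|) ^ (l + 2) := by
    rw [← mul_pow]
    refine le_trans ?_ (pow_le_pow_left₀ (by positivity) h2 _)
    rw [pow_add]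
    gcongr
    linarith
  calc |y| ^ l * ‖iteratedDeriv p φ (y + τ)‖ * (1 + |y|) ^ 2
      = (|y| ^ l * (1 + |y|) ^ 2) * ‖iteratedDeriv p φ (y + τ)‖ := by ring
    _ ≤ (1 + |τ|) ^ (l + 2) * (1 + |y + τ|) ^ (l + 2) * ‖iteratedDeriv p φ (y + τ)‖ := by gcongr
    _ ≤ _ := by
      rw [mul_assoc, mul_assoc]
      exact mul_le_mul_of_nonneg_left h1 (by positivity)

end

/-! ### Generators and coset representatives. -/

/-- A lattice in `ℝ` consists of the integer multiples of a positive number. -/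
lemma exists_pos_generator (L : Submodule ℤ ℝ) [DiscreteTopology L] [IsZLattice ℝ L] :
    ∃ a : ℝ, 0 < a ∧ ∀ x, x ∈ L ↔ ∃ n : ℤ, x = a * n := by
  have hfree : Module.Free ℤ L := ZLattice.module_free ℝ L
  have hrank : Module.finrank ℤ L = 1 := by rw [ZLattice.rank ℝ L]; simp
  obtain ⟨v, hv0, hv⟩ := finrank_eq_one_iff'.mp hrank
  have hv0' : (v : ℝ) ≠ 0 := fun h => hv0 (Subtype.ext h)
  have hgen : ∀ x ∈ L, ∃ n : ℤ, x = v * n := fun x hx => by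
    obtain ⟨n, hn⟩ := hv ⟨x, hx⟩
    refine ⟨n, ?_⟩
    have := congrArg Subtype.val hn
    simp only [Submodule.coe_smul, zsmul_eq_mul] at this
    rw [← this, mul_comm]
  have hmem : ∀ n : ℤ, (v : ℝ) * n ∈ L := fun n => by
    have := L.smul_mem n v.2
    rwa [zsmul_eq_mul, mul_comm] at this
  rcases hv0'.lt_or_gt with h | h
  · refine ⟨-v, neg_pos.mpr h, fun x => ⟨fun hx => ?_, ?_⟩⟩
    · obtain ⟨n, rfl⟩ := hgen x hx
      exact ⟨-n, by push_cast; ring⟩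
    · rintro ⟨n, rfl⟩
      simpa using hmem (-n)
  · refine ⟨v, h, fun x => ⟨hgen x, ?_⟩⟩
    rintro ⟨n, rfl⟩
    exact hmem n

/-- Finitely many cosets of `a ℤ` have representatives in `[0, a)`, and then the points of
their union are uniformly separated. -/
lemma exists_separated_representatives {a : ℝ} (ha : 0 < a) {T : Set ℝ} (hT : T.Finite) :
    ∃ (T' : Finset ℝ) (r : ℝ), 0 < r ∧
      (∀ τ ∈ T, ∀ n : ℤ, ∃ τ' ∈ T', ∃ k : ℤ, τ + a * n = a * k + τ') ∧
      ∀ i j : T' × ℤ, i ≠ j → r < |(a * i.2 + i.1) - (a * j.2 + j.1)| := by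
  classical
  set T' : Finset ℝ := hT.toFinset.image (toIcoMod ha 0) with hT'
  have hIco : ∀ τ ∈ T', 0 ≤ τ ∧ τ < a := by
    intro τ hτ
    obtain ⟨x, -, rfl⟩ := Finset.mem_image.mp hτ
    simpa using toIcoMod_mem_Ico ha 0 x
  have hgap : ∀ τ ∈ T', ∀ τ' ∈ T', 0 < a - |τ - τ'| := fun τ h τ' h' => by
    have h1 := hIco τ h
    have h2 := hIco τ' h'
    rw [sub_pos, abs_lt]
    constructor <;> linarith
  -- The first bound separates points with different multiples of `a`, the second those with equal
  -- multiples and different representatives.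
  obtain ⟨r, hr, hr0⟩ : ∃ r : ℝ, (∀ q ∈ T' ×ˢ T', r < a - |q.1 - q.2| ∧
      (q.1 ≠ q.2 → r < |q.1 - q.2|)) ∧ 0 < r := by
    have h1 : ∀ᶠ r in 𝓝[>] (0 : ℝ), ∀ q ∈ T' ×ˢ T', r < a - |q.1 - q.2| ∧
        (q.1 ≠ q.2 → r < |q.1 - q.2|) := by
      rw [Filter.eventually_all_finset]
      intro q hq
      rw [Finset.mem_product] at hq
      refine Filter.Eventually.and (nhdsWithin_le_nhds
        (Iio_mem_nhds (hgap _ hq.1 _ hq.2))) ?_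
      by_cases h : q.1 = q.2
      · simp [h]
      · filter_upwards [nhdsWithin_le_nhds (Iio_mem_nhds (abs_pos.mpr (sub_ne_zero.mpr h)))]
          with r hr _ using hr
    exact (h1.and self_mem_nhdsWithin).exists
  refine ⟨T', r, hr0, fun τ hτ n => ?_, fun i j hij => ?_⟩
  · refine ⟨toIcoMod ha 0 τ, Finset.mem_image_of_mem _ (hT.mem_toFinset.mpr hτ),
      n + toIcoDiv ha 0 τ, ?_⟩
    have := toIcoMod_add_toIcoDiv_zsmul ha 0 τ
    rw [zsmul_eq_mul] at this
    push_cast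
    linarith
  · obtain ⟨⟨τ, hτ⟩, n⟩ := i
    obtain ⟨⟨τ', hτ'⟩, k⟩ := j
    obtain ⟨h1, h2⟩ := hr (τ, τ') (Finset.mem_product.mpr ⟨hτ, hτ'⟩)
    simp only at h1 h2 ⊢
    by_cases hnk : n = k
    · subst hnk
      rw [add_sub_add_left_eq_sub]
      exact h2 fun h => hij (by subst h; rfl)
    · have h3 : (1 : ℝ) ≤ |(n : ℝ) - k| := by
        exact_mod_cast Int.one_le_abs (sub_ne_zero.mpr hnk)
      have h4 : a ≤ |a * (n - k)| := by
        rw [abs_mul, abs_of_pos ha]; nlinarith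
      have h5 : |a * ((n : ℝ) - k)| - |τ - τ'| ≤ |a * n + τ - (a * k + τ')| := by
        have := abs_sub_abs_le_abs_sub (a * ((n : ℝ) - k)) (-(τ - τ'))
        rw [abs_neg] at this
        refine this.trans (le_of_eq ?_)
        congr 1; ring
      linarith

/-! ### Assembling the representation. -/

namespace TemperedDistribution

open Distribution

/-- A tempered distribution on `ℝ` with locally finite spectrum whose support lies in finitely many
cosets of `a ℤ` is a finite combination of the series of `poissonTerm`. -/
theorem exists_eq_sum_tsum_poissonTerm (α : 𝓢'(ℝ, ℂ)) {a : ℝ} (ha : 0 < a) {T : Set ℝ}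
    (hT : T.Finite) (hsupp : ∀ x ∈ dsupport α, ∃ τ ∈ T, ∃ n : ℤ, x = τ + a * n)
    (hspec : IsLocallyFiniteSet (dsupport (𝓕 α : 𝓢'(ℝ, ℂ)))) :
    ∃ (Q : Finset (ℝ × ℝ × ℕ × ℕ)) (c : ℝ → ℝ → ℕ → ℕ → ℂ),
      α = ∑ q ∈ Q, c q.1 q.2.1 q.2.2.1 q.2.2.2 •
            ∑' n : ℤ, poissonTerm q.1 q.2.1 q.2.2.1 q.2.2.2 (a * n) := by
  classical
  have hsupp' : ∀ x ∈ dsupport α, ∃ τ ∈ T, ∃ n : ℤ, x = τ + n * a := by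
    simpa only [mul_comm] using hsupp
  have hloc := isLocallyFiniteSet_of_subset_translates hT ha hsupp'
  obtain ⟨s, hs, hrec⟩ := exists_diffOp_translates_eq_zero α ha hT hsupp' hspec
  obtain ⟨m, hm⟩ := exists_apply_eq_sum_jets α hloc
  obtain ⟨T', r, hr, hrep, hsep⟩ := exists_separated_representatives ha hT
  -- For fixed `τ` and `p` these are pairings with the translates by `a n` of one test function, so
  -- the recurrence applies.
  have hcoef : ∀ (τ : ℝ) (p : ℕ), ∃ c : (ℝ × ℕ) →₀ ℂ, ∀ n : ℤ,
      α ((jetBump hr p).compSubConstCLM ℂ (a * n + τ)) =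
        ∑ q ∈ c.support, c q * expMonomial a q.1 q.2 n := fun τ p => by
    have h1 := hrec ((jetBump hr p).compSubConstCLM ℂ τ)
    simp only [SchwartzMap.compSubConstCLM_comp] at h1
    obtain ⟨c, hc⟩ := exists_sum_of_mem_expPolySpan (mem_expPolySpan_of_diffOp ha.ne' hs h1)
    exact ⟨c, fun n => by rw [← hc n, add_comm, mul_comm]⟩
  choose c hc using hcoef
  set U : Finset (ℝ × ℕ) := T'.biUnion fun τ => (Finset.range m).biUnion fun p => (c τ p).support
    with hU
  set Θ := U.image Prod.fst with hΘ
  set Λ := U.image Prod.snd with hΛ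
  -- Padding with zero coefficients gives all `τ` and `p` the same rectangular set of pairs `(θ,
  -- l)`.
  have hcoef : ∀ τ ∈ T', ∀ p ∈ Finset.range m, ∀ n : ℤ,
      α ((jetBump hr p).compSubConstCLM ℂ (a * n + τ)) =
        ∑ θ ∈ Θ, ∑ l ∈ Λ, c τ p (θ, l) * expMonomial a θ l n := by
    intro τ hτ p hp n
    rw [hc, ← Finset.sum_product']
    refine Finset.sum_subset (fun q hq => ?_) fun q _ hq => ?_
    · have hqU : q ∈ U := Finset.mem_biUnion.mpr ⟨τ, hτ, Finset.mem_biUnion.mpr ⟨p, hp, hq⟩⟩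
      exact Finset.mem_product.mpr ⟨Finset.mem_image_of_mem _ hqU, Finset.mem_image_of_mem _ hqU⟩
    · rw [Finsupp.notMem_support_iff.mp hq, zero_mul]
  -- The factor `(-1) ^ p` cancels the sign in `δ^{(p)}`.
  refine ⟨T' ×ˢ Θ ×ˢ Λ ×ˢ Finset.range m, fun τ θ l p => (-1) ^ p * c τ p (θ, l), ?_⟩
  rw [← sub_eq_zero]
  -- By density compactly supported tests suffice, and against them every series is a finite sum.
  refine DFunLike.ext _ _ (apply_eq_zero_of_forall_hasCompactSupport _ fun φ hφ => ?_)
  rw [sub_apply, sub_eq_zero]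
  have hfin : {n : ℤ | ∃ τ ∈ T', a * n + τ ∈ tsupport φ}.Finite := by
    have h1 : ∀ τ ∈ T', {n : ℤ | a * n + τ ∈ tsupport φ}.Finite := fun τ _ => by
      obtain ⟨R, hR⟩ := hφ.isCompact.isBounded.subset_closedBall (0 : ℝ)
      refine (Set.finite_Icc ⌈(-R - τ) / a⌉ ⌊(R - τ) / a⌋).subset fun n hn => ?_
      have := hR hn
      rw [mem_closedBall_zero_iff, Real.norm_eq_abs, abs_le] at this
      refine ⟨?_, ?_⟩
      · rw [Int.ceil_le, div_le_iff₀ ha]; linarith [this.1]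
      · rw [Int.le_floor, le_div_iff₀ ha]; linarith [this.2]
    refine (T'.finite_toSet.biUnion h1).subset fun n hn => ?_
    obtain ⟨τ, hτ, h⟩ := hn
    exact Set.mem_iUnion₂.mpr ⟨τ, hτ, h⟩
  have hα := hm (fun i : T' × ℤ => a * i.2 + i.1) hr (fun x hx => by
    obtain ⟨τ, hτ, n, rfl⟩ := hsupp x hx
    obtain ⟨τ', hτ', k, h⟩ := hrep τ hτ n
    exact ⟨(⟨τ', hτ'⟩, k), h.symm⟩) hsep φ hφ (Finset.univ ×ˢ hfin.toFinset) (fun i hi => by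
      simp only [Finset.mem_product, Finset.mem_univ, true_and, Set.Finite.mem_toFinset]
      exact ⟨i.1, i.1.2, hi⟩)
  rw [hα, Finset.sum_product]
  have hser : ∀ τ ∈ T', ∀ θ l p, (∑' n : ℤ, poissonTerm τ θ l p (a * n)) φ =
      ∑ n ∈ hfin.toFinset, expMonomial a θ l n * ((-1) ^ p * iteratedDeriv p φ (a * n + τ)) := by
    intro τ hτ θ l p
    have h1 := (PointwiseConvergenceCLM.evalCLM (RingHom.id ℂ) ℂ φ).map_tsum
      (summable_poissonTerm ha τ θ l p)
    refine h1.trans ?_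
    change ∑' n : ℤ, poissonTerm τ θ l p (a * n) φ = _
    simp only [poissonTerm_apply]
    refine tsum_eq_sum fun n hn => ?_
    rw [iteratedDeriv_eq_zero_of_notMem_tsupport (fun h => hn ?_), mul_zero, mul_zero]
    exact (Set.Finite.mem_toFinset _).mpr ⟨τ, hτ, h⟩
  rw [sum_apply, Finset.sum_product, Finset.sum_coe_sort T' fun τ => ∑ n ∈ hfin.toFinset,
    ∑ p ∈ Finset.range m, iteratedDeriv p φ (a * n + τ) *
      α ((jetBump hr p).compSubConstCLM ℂ (a * n + τ))]
  refine Finset.sum_congr rfl fun τ hτ => ?_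
  rw [Finset.sum_product]
  simp only [Finset.sum_product, smul_apply, smul_eq_mul, hser τ hτ]
  have h1 : ∀ n ∈ hfin.toFinset, ∑ p ∈ Finset.range m, iteratedDeriv p φ (a * n + τ) *
      α ((jetBump hr p).compSubConstCLM ℂ (a * n + τ)) = ∑ θ ∈ Θ, ∑ l ∈ Λ, ∑ p ∈ Finset.range m,
        iteratedDeriv p φ (a * n + τ) * (c τ p (θ, l) * expMonomial a θ l n) := by
    intro n _
    rw [Finset.sum_congr rfl fun p hp => by rw [hcoef τ hτ p hp n, Finset.mul_sum]]
    rw [Finset.sum_comm]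
    refine Finset.sum_congr rfl fun θ _ => ?_
    simp only [Finset.mul_sum]
    rw [Finset.sum_comm]
  rw [Finset.sum_congr rfl h1, Finset.sum_comm]
  refine Finset.sum_congr rfl fun θ _ => ?_
  rw [Finset.sum_comm]
  refine Finset.sum_congr rfl fun l _ => ?_
  rw [Finset.sum_comm]
  refine Finset.sum_congr rfl fun p _ => ?_
  rw [Finset.mul_sum]
  refine Finset.sum_congr rfl fun n _ => ?_
  have : ((-1 : ℂ) ^ p) * (-1) ^ p = 1 := by rw [← mul_pow]; simp
  linear_combination (-(iteratedDeriv p φ (a * n + τ) * c τ p (θ, l) * expMonomial a θ l n)) * this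

end TemperedDistribution

theorem theorem5p1 (L : Submodule ℤ ℝ) [DiscreteTopology L] [IsZLattice ℝ L]
    (α : 𝓢'(ℝ, ℂ))
    (hsupp : ∃ T : Set ℝ, T.Finite ∧ Distribution.dsupport α ⊆ ⋃ τ ∈ T, (τ +ᵥ (L : Set ℝ)))
    (hspec : IsLocallyFiniteSet (Distribution.dsupport (𝓕 α : 𝓢'(ℝ, ℂ)))) :
    ∃ (Q : Finset (ℝ × ℝ × ℕ × ℕ)) (c : ℝ → ℝ → ℕ → ℕ → ℂ),
      (∀ τ ω l p, (τ, ω, l, p) ∈ Q → Summable (fun y : L => poissonTerm τ ω l p (y : ℝ))) ∧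
      α = ∑ q ∈ Q, c q.1 q.2.1 q.2.2.1 q.2.2.2 •
            ∑' y : L, poissonTerm q.1 q.2.1 q.2.2.1 q.2.2.2 (y : ℝ) := by
  obtain ⟨T, hT, hsub⟩ := hsupp
  obtain ⟨a, ha, hL⟩ := exists_pos_generator L
  let e : ℤ ≃ L := Equiv.ofBijective (fun n => ⟨a * n, (hL _).mpr ⟨n, rfl⟩⟩) ⟨fun n k h => by
      simpa [ha.ne'] using congrArg Subtype.val h, fun y => by
      obtain ⟨n, hn⟩ := (hL y).mp y.2
      exact ⟨n, Subtype.ext hn.symm⟩⟩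
  obtain ⟨Q, c, h⟩ := TemperedDistribution.exists_eq_sum_tsum_poissonTerm α ha hT (fun x hx => by
    obtain ⟨τ, hτ, y, hy, rfl⟩ := Set.mem_iUnion₂.mp (hsub hx)
    obtain ⟨n, rfl⟩ := (hL y).mp hy
    exact ⟨τ, hτ, n, rfl⟩) hspec
  refine ⟨Q, c, fun τ θ l p _ => ?_, h.trans (Finset.sum_congr rfl fun q _ => ?_)⟩
  · exact e.summable_iff.mp (summable_poissonTerm ha τ θ l p)
  · rw [← e.tsum_eq]
    rfl
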